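/- Let $\mathbb{F}$ be a fixed finite field. A CI instance is a triple $(n,P,Q)$ with $n\in\mathbb{N}$ and $P,Q\subseteq[n]\times[n]$; it belongs to $CI$ if there are $A,B\in\mathbb{F}^{n\times n}$ with $A_{ij}=0$ for all $(i,j)\in P$, $B_{ij}=0$ for all $(i,j)\in Q$, and $AB=I_n$. A (two-parameter) persistence module is a functor $M$ from the poset $\mathbb{R}^2$ (componentwise order) to $\mathbb{F}$-vector spaces, and $M^\epsilon$ is its shift, $M^\epsilon_p=M_{p+(\epsilon,\epsilon)}$. For $\epsilon\ge 0$, $M$ and $N$ are $\epsilon$-interleaved if there are morphisms $f\colon M\to N^\epsilon$, $g\colon N\to M^\epsilon$ such that $g^\epsilon\circ f$ and $f^\epsilon\circ g$ are the morphisms $M\to M^{2\epsilon}$, $N\to N^{2\epsilon}$ given by the internal maps; $d_I(M,N)\in[0,\infty]$ is the infimum of all such $\epsilon$. An interval is a non-empty subset $S\subseteq\mathbb{R}^2$ that is convex ($a\le b\le c$ and $a,c\in S$ imply $b\in S$) and connected through finite sequences of points of $S$ with consecutive points comparable; its interval module is $\mathbb{F}$ at the points of $S$ and $0$ elsewhere,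 with identity maps inside $S$ and zero maps otherwise. A module is interval decomposable if it is isomorphic to a finite direct sum of interval modules. A staircase is a set $\bigcup_{i=1}^k\{x\in\mathbb{R}^2\mid a_i\le x\}$ with $k\ge 1$ and $a_1,\dots,a_k\in\mathbb{R}^2$, and a staircase module is the interval module of a staircase. A graded matrix representation consists of a matrix $A\in\mathbb{F}^{m\times s}$ whose columns (generators) and rows (relations) carry grades $g_1,\dots,g_s$ and $r_1,\dots,r_m$ in $\mathbb{R}^2$, where $A_{ij}\ne 0$ implies $g_j\le r_i$; it represents the module with $M_p=\mathrm{Gen}_p/\mathrm{Rel}_p$, where $\mathrm{Gen}_p$ is spanned by the basis vectors $e_j$ with $g_j\le p$ and $\mathrm{Rel}_p$ by the rows of $A$ with grade $\le p$, and with internal maps $[x]_p\mapsto[x]_q$. **Theorem.** There is an algorithm (a Turing machine) that, given a CI instance $(n,P,Q)$, computes in time polynomial in $n$ a pair of graded matrix representations over $\mathbb{F}$, with integral grades written in binary, such that for every $n\geq 1$ the persistence modules $M$ and $N$ over $\mathbb{R}^2$ that they represent satisfy $$d_I(M,N)=\begin{cases}1&\text{if }(n,P,Q)\in CI,\\ 3&\text{if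 }(n,P,Q)\notin CI.\end{cases}$$ Moreover, each of $M$ and $N$ is isomorphic to a direct sum of $n$ staircase modules, and hence is interval decomposable. -/

import Mathlib

open scoped NNReal ENNReal

universe u

/-! ### The constrained invertibility problem -/

/-- An instance `(n, P, Q)` of the constrained invertibility problem. -/
structure CIInstance where
  n : ℕ
  P : Finset (Fin n × Fin n)
  Q : Finset (Fin n × Fin n)

/-- The instance belongs to the language CI over the field `F`. -/
def CIInstance.InCI (F : Type u) [Field F] (I : CIInstance) : Prop :=
  ∃ A B : Matrix (Fin I.n) (Fin I.n) F,
    (∀ ij ∈ I.P, A ij.1 ij.2 = 0) ∧ (∀ ij ∈ I.Q, B ij.1 ij.2 = 0) ∧ A * B = 1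

/-! ### Persistence modules -/

/-- A two-parameter persistence module over `F`. -/
structure PersistenceModule (F : Type u) [Field F] where
  obj : ℝ × ℝ → Type u
  [addCommGroup : ∀ p, AddCommGroup (obj p)]
  [module : ∀ p, Module F (obj p)]
  map : ∀ {p q : ℝ × ℝ}, p ≤ q → (obj p →ₗ[F] obj q)
  map_id : ∀ (p : ℝ × ℝ), map (le_refl p) = LinearMap.id
  map_comp : ∀ {p q r : ℝ × ℝ} (hpq : p ≤ q) (hqr : q ≤ r),
    map hqr ∘ₗ map hpq = map (hpq.trans hqr)

attribute [instance] PersistenceModule.addCommGroup PersistenceModule.module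

namespace PersistenceModule

variable {F : Type u} [Field F]

/-- A morphism of persistence modules. -/
structure Hom (M N : PersistenceModule F) where
  app : ∀ p : ℝ × ℝ, M.obj p →ₗ[F] N.obj p
  naturality : ∀ {p q : ℝ × ℝ} (h : p ≤ q), N.map h ∘ₗ app p = app q ∘ₗ M.map h

/-- `M` and `N` are isomorphic: some morphism is an isomorphism at every point. -/
def Isomorphic (M N : PersistenceModule F) : Prop :=
  ∃ f : Hom M N, ∀ p, Function.Bijective (f.app p)

/-- The diagonal translate `p + ε = (p_x + ε, p_y + ε)`. -/
def translate (p : ℝ × ℝ) (ε : ℝ) : ℝ × ℝ := (p.1 + ε, p.2 + ε)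

theorem translate_mono {p q : ℝ × ℝ} (h : p ≤ q) (ε : ℝ) : translate p ε ≤ translate q ε :=
  ⟨add_le_add_left h.1 ε, add_le_add_left h.2 ε⟩

theorem le_translate (p : ℝ × ℝ) {ε : ℝ} (h : 0 ≤ ε) : p ≤ translate p ε :=
  ⟨le_add_of_nonneg_right h, le_add_of_nonneg_right h⟩

/-- The `ε`-shift of a persistence module. -/
def shift (M : PersistenceModule F) (ε : ℝ) : PersistenceModule F where
  obj p := M.obj (translate p ε)
  map h := M.map (translate_mono h ε)
  map_id p := M.map_id (translate p ε)
  map_comp hpq hqr := M.map_comp (translate_mono hpq ε) (translate_mono hqr ε)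

/-- `M` and `N` are `ε`-interleaved: there are morphisms `f : M → N^ε` and `g : N → M^ε` such that
both composites `g^ε ∘ f` and `f^ε ∘ g` are given by the internal maps from `p` to
`(p + ε) + ε = p + 2ε`. -/
def Interleaved (M N : PersistenceModule F) (ε : ℝ≥0) : Prop :=
  ∃ (f : Hom M (N.shift ε)) (g : Hom N (M.shift ε)),
    (∀ (p : ℝ × ℝ) (x : M.obj p), g.app (translate p ε) (f.app p x) =
      M.map ((le_translate p ε.2).trans (le_translate (translate p ε) ε.2)) x) ∧
    (∀ (p : ℝ × ℝ) (y : N.obj p), f.app (translate p ε) (g.app p y) =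
      N.map ((le_translate p ε.2).trans (le_translate (translate p ε) ε.2)) y)

/-- The interleaving distance, with value `∞` if there is no interleaving. -/
noncomputable def interleavingDist (M N : PersistenceModule F) : ℝ≥0∞ :=
  ⨅ (ε : ℝ≥0) (_ : Interleaved M N ε), (ε : ℝ≥0∞)

/-- The direct sum of `k` persistence modules (a finite direct sum, written as a product). -/
def directSum {k : ℕ} (M : Fin k → PersistenceModule F) : PersistenceModule F where
  obj p := ∀ i, (M i).obj p
  map h := LinearMap.pi fun i => (M i).map h ∘ₗ LinearMap.proj i
  map_id p := by
    refine LinearMap.ext fun x => funext fun i => ?_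
    exact LinearMap.congr_fun ((M i).map_id p) (x i)
  map_comp hpq hqr := by
    refine LinearMap.ext fun x => funext fun i => ?_
    exact LinearMap.congr_fun ((M i).map_comp hpq hqr) (x i)

end PersistenceModule

/-! ### Interval modules and staircases -/

/-- An interval in the poset `ℝ²`: non-empty, convex, and connected by chains of comparable
points of the set. -/
structure IsPlaneInterval (S : Set (ℝ × ℝ)) : Prop where
  nonempty : S.Nonempty
  convex : ∀ {a b c : ℝ × ℝ}, a ∈ S → c ∈ S → a ≤ b → b ≤ c → b ∈ S
  connected : ∀ {a c : ℝ × ℝ}, a ∈ S → c ∈ S →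
    Relation.ReflTransGen (fun x y => x ∈ S ∧ y ∈ S ∧ (x ≤ y ∨ y ≤ x)) a c

/-- The space of the interval module of `S` at `p`: all of `F` if `p ∈ S`, and `0` otherwise. -/
def intervalFiber (F : Type u) [Field F] (S : Set (ℝ × ℝ)) (p : ℝ × ℝ) : Submodule F F where
  carrier := {x | p ∉ S → x = 0}
  zero_mem' := fun _ => rfl
  add_mem' := fun hx hy hp => by rw [hx hp, hy hp, add_zero]
  smul_mem' := fun c x hx hp => by rw [hx hp, smul_zero]

open Classical in
/-- The internal map of the interval module of `S`: the identity if `p, q ∈ S`, and `0`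
otherwise. -/
noncomputable def intervalMap (F : Type u) [Field F] (S : Set (ℝ × ℝ)) (p q : ℝ × ℝ) :
    intervalFiber F S p →ₗ[F] intervalFiber F S q where
  toFun x := ⟨if p ∈ S ∧ q ∈ S then (x : F) else 0, fun hq => if_neg fun h => hq h.2⟩
  map_add' x y := by
    ext
    by_cases h : p ∈ S ∧ q ∈ S <;> simp [h]
  map_smul' c x := by
    ext
    by_cases h : p ∈ S ∧ q ∈ S <;> simp [h]

/-- The interval module associated to an interval `S`. -/
noncomputable def intervalModule (F : Type u) [Field F] (S : Set (ℝ × ℝ))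
    (hS : IsPlaneInterval S) : PersistenceModule F where
  obj p := intervalFiber F S p
  map {p q} _ := intervalMap F S p q
  map_id p := by
    refine LinearMap.ext fun x => Subtype.ext ?_
    by_cases h : p ∈ S
    · simp [intervalMap, h]
    · simp [intervalMap, h, x.2 h]
  map_comp {p q r} hpq hqr := by
    refine LinearMap.ext fun x => Subtype.ext ?_
    by_cases hp : p ∈ S
    · by_cases hr : r ∈ S
      · have hq : q ∈ S := hS.convex hp hr hpq hqr
        simp [intervalMap, hp, hq, hr]
      · simp [intervalMap, hr]
    · simp [intervalMap, hp]

/-- `M` is isomorphic to a direct sum of finitely many interval modules. -/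
def PersistenceModule.IntervalDecomposable {F : Type u} [Field F] (M : PersistenceModule F) :
    Prop :=
  ∃ (l : ℕ) (S : Fin l → Set (ℝ × ℝ)) (hS : ∀ i, IsPlaneInterval (S i)),
    M.Isomorphic (PersistenceModule.directSum fun i => intervalModule F (S i) (hS i))

/-- The staircase with elements `a ∈ C`: the union of the quadrants `{x | a ≤ x}`. -/
def staircase (C : Finset (ℝ × ℝ)) : Set (ℝ × ℝ) := {x | ∃ a ∈ C, a ≤ x}

theorem isPlaneInterval_staircase {C : Finset (ℝ × ℝ)} (hC : C.Nonempty) :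
    IsPlaneInterval (staircase C) where
  nonempty := let ⟨a, ha⟩ := hC; ⟨a, a, ha, le_refl a⟩
  convex := by
    rintro a b c ⟨d, hd, hda⟩ - hab -
    exact ⟨d, hd, hda.trans hab⟩
  connected := by
    rintro a c ⟨d, hd, hda⟩ ⟨e, he, hec⟩
    have h : a ⊔ c ∈ staircase C := ⟨d, hd, hda.trans le_sup_left⟩
    exact (Relation.ReflTransGen.single ⟨⟨d, hd, hda⟩, h, Or.inl le_sup_left⟩).tail
      ⟨h, ⟨e, he, hec⟩, Or.inr le_sup_right⟩

/-- The staircase module of a non-empty finite set of elements. -/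
noncomputable def staircaseModule (F : Type u) [Field F] (C : Finset (ℝ × ℝ))
    (hC : C.Nonempty) : PersistenceModule F :=
  intervalModule F (staircase C) (isPlaneInterval_staircase hC)

/-- `M` is isomorphic to a direct sum of `k` staircase modules. -/
def PersistenceModule.IsSumOfStaircases {F : Type u} [Field F] (M : PersistenceModule F)
    (k : ℕ) : Prop :=
  ∃ (C : Fin k → Finset (ℝ × ℝ)) (hC : ∀ i, (C i).Nonempty),
    M.Isomorphic (PersistenceModule.directSum fun i => staircaseModule F (C i) (hC i))

/-! ### Graded matrices -/

/-- A graded matrix with grades in `R × R`: every column is a generator with a grade, every row is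
a relation with a grade, and a relation only involves generators present at its grade. -/
structure GradedMatrix (R F : Type*) [LE R] [Zero F] where
  numGens : ℕ
  numRels : ℕ
  gens : Fin numGens → R × R
  rels : Fin numRels → R × R
  matrix : Matrix (Fin numRels) (Fin numGens) F
  homogeneous : ∀ i j, matrix i j ≠ 0 → gens j ≤ rels i

namespace GradedMatrix

/-- A graded matrix with integral grades, regarded as one with real grades. -/
def toReal {F : Type*} [Zero F] (X : GradedMatrix ℤ F) : GradedMatrix ℝ F where
  numGens := X.numGens
  numRels := X.numRels
  gens j := (((X.gens j).1 : ℝ), ((X.gens j).2 : ℝ))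
  rels i := (((X.rels i).1 : ℝ), ((X.rels i).2 : ℝ))
  matrix := X.matrix
  homogeneous i j h :=
    ⟨Int.cast_le.2 (X.homogeneous i j h).1, Int.cast_le.2 (X.homogeneous i j h).2⟩

variable {F : Type u} [Field F] (X : GradedMatrix ℝ F)

/-- `Gen_p`: the direct sum of the copies of `F` belonging to the generators of grade `≤ p`. -/
def genSpace (p : ℝ × ℝ) : Submodule F (Fin X.numGens → F) where
  carrier := {x | ∀ j, ¬ X.gens j ≤ p → x j = 0}
  zero_mem' := fun _ _ => rfl
  add_mem' := fun hx hy j hj => by rw [Pi.add_apply, hx j hj, hy j hj, add_zero]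
  smul_mem' := fun c x hx j hj => by rw [Pi.smul_apply, hx j hj, smul_zero]

/-- `Rel_p`: the span of the rows of grade `≤ p`. -/
def relSpace (p : ℝ × ℝ) : Submodule F (Fin X.numGens → F) :=
  Submodule.span F {c | ∃ i, X.rels i ≤ p ∧ c = X.matrix i}

theorem genSpace_mono {p q : ℝ × ℝ} (h : p ≤ q) : X.genSpace p ≤ X.genSpace q :=
  fun _ hx j hj => hx j fun hp => hj (hp.trans h)

theorem relSpace_mono {p q : ℝ × ℝ} (h : p ≤ q) : X.relSpace p ≤ X.relSpace q :=
  Submodule.span_mono fun _ ⟨i, hi, hc⟩ => ⟨i, hi.trans h, hc⟩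

theorem relSpace_le_genSpace (p : ℝ × ℝ) : X.relSpace p ≤ X.genSpace p := by
  refine Submodule.span_le.2 ?_
  rintro _ ⟨i, hi, rfl⟩ j hj
  by_contra h
  exact hj ((X.homogeneous i j h).trans hi)

/-- `Rel_p` as a subspace of `Gen_p`. -/
def relIn (p : ℝ × ℝ) : Submodule F (X.genSpace p) :=
  (X.relSpace p).comap (X.genSpace p).subtype

/-- The persistence module `M_p = Gen_p / Rel_p`, with internal maps `[x]_p ↦ [x]_q`, represented
by a graded matrix. -/
def toModule : PersistenceModule F where
  obj p := X.genSpace p ⧸ X.relIn p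
  map {p q} h := (X.relIn p).mapQ (X.relIn q) (Submodule.inclusion (X.genSpace_mono h))
    fun _ hx => X.relSpace_mono h hx
  map_id p := by
    refine Submodule.linearMap_qext _ ?_
    ext x : 1
    rfl
  map_comp hpq hqr := by
    refine Submodule.linearMap_qext _ ?_
    ext x : 1
    rfl

/-- The persistence module over `ℝ²` represented by a graded matrix with integral grades. -/
def persistenceModule {F : Type u} [Field F] (X : GradedMatrix ℤ F) : PersistenceModule F :=
  X.toReal.toModule

end GradedMatrix

/-! ### Encodings over finite alphabets -/

/-- The bits of the indicator matrix of `P ⊆ [n] × [n]`, row by row. -/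
def encodePairs {n : ℕ} (P : Finset (Fin n × Fin n)) : List Bool :=
  (List.finRange n).flatMap fun i => (List.finRange n).map fun j => decide ((i, j) ∈ P)

theorem length_encodePairs {n : ℕ} (P : Finset (Fin n × Fin n)) :
    (encodePairs P).length = n * n := by
  simp [encodePairs, List.length_flatMap]

/-- An instance `(n, P, Q)` is written as `n` in unary, followed by the indicator matrices of
`P` and `Q`. -/
def CIInstance.encode (I : CIInstance) : List Bool :=
  List.replicate I.n true ++ false :: (encodePairs I.P ++ encodePairs I.Q)

/-- A bound that is polynomial in the length of the input is polynomial in `n`. -/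
theorem CIInstance.length_encode (I : CIInstance) : I.encode.length = 2 * I.n ^ 2 + I.n + 1 := by
  simp [CIInstance.encode, length_encodePairs]
  ring

/-- The alphabet used to write graded matrices over `F`. -/
inductive GMSymbol (F : Type u) : Type u where
  | bit (b : Bool)
  | entry (x : F)
  | comma
  | semicolon

/-- An integer is written in binary: a sign bit, the binary digits of its absolute value, and a
comma. -/
def encodeInt (F : Type u) (z : ℤ) : List (GMSymbol F) :=
  GMSymbol.bit (decide (z < 0)) ::
    ((Computability.encodeNat z.natAbs).map GMSymbol.bit ++ [GMSymbol.comma])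

/-- The two coordinates of a grade, one after the other. -/
def encodeGrade (F : Type u) (p : ℤ × ℤ) : List (GMSymbol F) :=
  encodeInt F p.1 ++ encodeInt F p.2

/-- A graded matrix is written as the list of the grades of its columns, the list of the grades of
its rows, and the list of its entries row by row. -/
def GradedMatrix.encode {F : Type u} [Zero F] (X : GradedMatrix ℤ F) : List (GMSymbol F) :=
  (List.finRange X.numGens).flatMap (fun j => encodeGrade F (X.gens j)) ++
    GMSymbol.semicolon ::
  ((List.finRange X.numRels).flatMap (fun i => encodeGrade F (X.rels i)) ++
    GMSymbol.semicolon ::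
  ((List.finRange X.numRels).flatMap (fun i =>
      (List.finRange X.numGens).map fun j => GMSymbol.entry (X.matrix i j)) ++
    [GMSymbol.semicolon]))

/-- A pair of graded matrices is written one after the other. -/
def encodeGMPair {F : Type u} [Zero F] (X : GradedMatrix ℤ F × GradedMatrix ℤ F) :
    List (GMSymbol F) :=
  X.1.encode ++ X.2.encode

/-! The encodings are injective. -/

theorem flatMap_encode_cancel {α β : Type*} (e : α → List β) (c : β)
    (he : ∀ a b s t, e a ++ s = e b ++ t → a = b ∧ s = t)
    (hc : ∀ a s t, e a ++ s ≠ c :: t) :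
    ∀ (l l' : List α) (s t : List β), l.flatMap e ++ c :: s = l'.flatMap e ++ c :: t →
      l = l' ∧ s = t
  | [], [], s, t, h => by simpa using h
  | [], b :: l', s, t, h => by
    rw [List.flatMap_cons, List.append_assoc] at h
    exact absurd h.symm (hc _ _ _)
  | a :: l, [], s, t, h => by
    rw [List.flatMap_cons, List.append_assoc] at h
    exact absurd h (hc _ _ _)
  | a :: l, b :: l', s, t, h => by
    rw [List.flatMap_cons, List.flatMap_cons, List.append_assoc, List.append_assoc] at h
    obtain ⟨rfl, h'⟩ := he _ _ _ _ h
    obtain ⟨rfl, rfl⟩ := flatMap_encode_cancel e c he hc l l' s t h'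
    exact ⟨rfl, rfl⟩

theorem encodeInt_cancel (F : Type u) (a b : ℤ) (s t : List (GMSymbol F))
    (h : encodeInt F a ++ s = encodeInt F b ++ t) : a = b ∧ s = t := by
  simp only [encodeInt, List.cons_append, List.append_assoc, List.nil_append, List.cons.injEq,
    GMSymbol.bit.injEq] at h
  obtain ⟨h1, h2⟩ := h
  rw [← List.flatMap_singleton' ((Computability.encodeNat a.natAbs).map GMSymbol.bit),
    ← List.flatMap_singleton' ((Computability.encodeNat b.natAbs).map GMSymbol.bit),
    List.flatMap_map, List.flatMap_map] at h2
  obtain ⟨h3, h4⟩ := flatMap_encode_cancel (fun x : Bool => [GMSymbol.bit (F := F) x])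
    GMSymbol.comma (by simp) (by simp) _ _ _ _ h2
  have h5 : a.natAbs = b.natAbs := Computability.encodingNatBool.encode_injective h3
  refine ⟨?_, h4⟩
  rw [decide_eq_decide] at h1
  omega

theorem encodeGrade_cancel (F : Type u) (p q : ℤ × ℤ) (s t : List (GMSymbol F))
    (h : encodeGrade F p ++ s = encodeGrade F q ++ t) : p = q ∧ s = t := by
  rw [encodeGrade, encodeGrade, List.append_assoc, List.append_assoc] at h
  obtain ⟨h1, h2⟩ := encodeInt_cancel F _ _ _ _ h
  obtain ⟨h3, h4⟩ := encodeInt_cancel F _ _ _ _ h2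
  exact ⟨Prod.ext h1 h3, h4⟩

theorem encodeGrades_cancel (F : Type u) {m n : ℕ} (g : Fin m → ℤ × ℤ) (g' : Fin n → ℤ × ℤ)
    (s t : List (GMSymbol F))
    (h : (List.finRange m).flatMap (fun j => encodeGrade F (g j)) ++ GMSymbol.semicolon :: s =
      (List.finRange n).flatMap (fun j => encodeGrade F (g' j)) ++ GMSymbol.semicolon :: t) :
    (List.ofFn g = List.ofFn g') ∧ s = t := by
  rw [← List.flatMap_map g, ← List.flatMap_map g', ← List.ofFn_eq_map, ← List.ofFn_eq_map] at h
  exact flatMap_encode_cancel _ _ (encodeGrade_cancel F)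
    (by intro a s t; simp [encodeGrade, encodeInt]) _ _ _ _ h

theorem rows_cancel {ι α : Type*} {m : ℕ} (f g : ι → Fin m → α) :
    ∀ (l : List ι) (s t : List α),
      l.flatMap (fun i => (List.finRange m).map fun j => f i j) ++ s =
        l.flatMap (fun i => (List.finRange m).map fun j => g i j) ++ t →
      (∀ i ∈ l, f i = g i) ∧ s = t
  | [], s, t, h => ⟨by simp, by simpa using h⟩
  | i :: l, s, t, h => by
    rw [List.flatMap_cons, List.flatMap_cons, List.append_assoc, List.append_assoc] at h
    obtain ⟨h1, h2⟩ := List.append_inj h (by simp)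
    obtain ⟨h3, h4⟩ := rows_cancel f g l s t h2
    refine ⟨?_, h4⟩
    rw [List.forall_mem_cons]
    exact ⟨funext fun j => List.map_inj_left.1 h1 j (List.mem_finRange j), h3⟩

theorem GradedMatrix.encode_cancel {F : Type u} [Zero F] (X Y : GradedMatrix ℤ F)
    (s t : List (GMSymbol F)) (h : X.encode ++ s = Y.encode ++ t) : X = Y ∧ s = t := by
  obtain ⟨m, k, g, r, A, hA⟩ := X
  obtain ⟨m', k', g', r', A', hA'⟩ := Y
  simp only [GradedMatrix.encode, List.append_assoc, List.cons_append, List.nil_append] at h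
  obtain ⟨h1, h3⟩ := encodeGrades_cancel F _ _ _ _ h
  obtain ⟨h2, h4⟩ := encodeGrades_cancel F _ _ _ _ h3
  clear h h3
  obtain rfl : m = m' := by simpa using congrArg List.length h1
  obtain rfl : k = k' := by simpa using congrArg List.length h2
  obtain rfl := List.ofFn_injective h1
  obtain rfl := List.ofFn_injective h2
  obtain ⟨h5, h6⟩ := rows_cancel (fun i j => GMSymbol.entry (A i j))
    (fun i j => GMSymbol.entry (A' i j)) _ _ _ h4
  obtain rfl : A = A' := by
    funext i j
    exact GMSymbol.entry.inj (congrFun (h5 i (List.mem_finRange i)) j)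
  exact ⟨rfl, List.tail_eq_of_cons_eq h6⟩

theorem encodeGMPair_injective (F : Type u) [Zero F] :
    Function.Injective (encodeGMPair (F := F)) := by
  intro X Y h
  obtain ⟨h1, h2⟩ := GradedMatrix.encode_cancel _ _ _ _ h
  obtain ⟨h3, -⟩ := GradedMatrix.encode_cancel _ _ [] [] (by simpa using h2)
  exact Prod.ext h1 h3

theorem encodePairs_cancel {n : ℕ} (P Q : Finset (Fin n × Fin n)) (s t : List Bool)
    (h : encodePairs P ++ s = encodePairs Q ++ t) : P = Q ∧ s = t := by
  obtain ⟨h1, h2⟩ := rows_cancel (fun i j => decide ((i, j) ∈ P))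
    (fun i j => decide ((i, j) ∈ Q)) _ _ _ h
  refine ⟨Finset.ext fun ⟨i, j⟩ => ?_, h2⟩
  exact decide_eq_decide.1 (congrFun (h1 i (List.mem_finRange i)) j)

theorem CIInstance.encode_injective : Function.Injective CIInstance.encode := by
  rintro ⟨n, P, Q⟩ ⟨m, P', Q'⟩ h
  have hn : 2 * n ^ 2 + n + 1 = 2 * m ^ 2 + m + 1 := by
    simpa only [CIInstance.length_encode] using congrArg List.length h
  obtain rfl : n = m := by
    rcases lt_trichotomy n m with hlt | heq | hlt
    · nlinarith
    · exact heq
    · nlinarith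
  have h1 := List.tail_eq_of_cons_eq (List.append_cancel_left h)
  obtain ⟨rfl, h2⟩ := encodePairs_cancel _ _ _ _ h1
  obtain ⟨rfl, -⟩ := encodePairs_cancel Q Q' [] [] (by simpa using h2)
  rfl

/-!
An invertible matrix and its inverse with prescribed zeros are encoded by an interleaving of two
direct sums of `n` staircase modules. At a point above all corners both modules are `F ^ n`, so that
a morphism `M → N^ε` is a matrix over `F`, whose entry `(i, j)` may differ from zero if and only if
the translate of the staircase `i` of `M` is contained in the staircase `j` of `N`. Hence `M` and
`N` are `ε`-interleaved if and only if there are mutually inverse matrices with the zero patterns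
given by these containments (`interleaved_staircaseSum_iff`).

All staircases have one corner in each of `2 * n + 1` slots. The coordinates in slot `t` are
`8 * 2 ^ t`, plus an offset in `{0, 1, 2, 3}`, and `2 ^ (2 * n - t + 2)`. Distinct slots are so far
apart that, for `ε < 3`, only corners in the same slot are comparable after a translation by `ε`, so
that a containment amounts to a bound on the differences of offsets
(`Reduction.offsetVal_le_of_translate_mem`). Slot `0` forces `ε ≥ 1` if the matrix `N → M` is not
zero.
In the slot of row `a` of `P`, the difference of the offsets is `3` for the pairs `(a, j) ∈ P`,
which forbids the corresponding entries of the matrix `M → N` for `ε < 3`, and at most `1` for the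
other pairs. The slots of the rows of `Q` do the same for the matrix `N → M`. Since no two offsets
differ by more than `3`, the two modules are always `3`-interleaved. They are `ε`-interleaved with
`ε < 3` only if the instance is solvable, and then they are `1`-interleaved, but for no smaller `ε`.

A staircase module has one generator for each slot, and one relation that identifies the generators
of two consecutive slots (`Reduction.isomorphic_staircaseSum`). Because the coordinates are powers
of two up to the offsets, their binary digits are written by counting exponents in unary, and no
arithmetic is needed to compute the graded matrices.

The machine is obtained from a program in a small language with loops, `StackProg`, whose
big-step semantics `StackProg.Run` counts the loop entries; `StackProg.machine` compiles such
programs, with one label for every loop. As an output stack is written from its end, the program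
first moves all offsets to auxiliary stacks and then writes the two descriptions backwards
(`Reduction.does_reduction`).
-/

/-! ### A structured language for stack machines -/

/-- Programs acting on stacks `k : K` with alphabets `Γ k` and a register with values in `σ`.
`popWhile k f c p` pops the stack `k` into the register by means of `f`, and, as long as the
register then satisfies `c`, runs `p` and starts again. -/
inductive StackProg (K : Type) (Γ : K → Type) (σ : Type) : Type
  | push (k : K) (a : σ → Γ k)
  | pop (k : K) (f : σ → Option (Γ k) → σ)
  | load (f : σ → σ)
  | seq (p q : StackProg K Γ σ)
  | ite (c : σ → Bool) (p q : StackProg K Γ σ)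
  | popWhile (k : K) (f : σ → Option (Γ k) → σ) (c : σ → Bool) (p : StackProg K Γ σ)

namespace StackProg

variable {K : Type} {Γ : K → Type} {σ : Type}

/-- The labels of the machine running a program: one for every loop. -/
def Label : StackProg K Γ σ → Type
  | push _ _ => Empty
  | pop _ _ => Empty
  | load _ => Empty
  | seq p q => Label p ⊕ Label q
  | ite _ p q => Label p ⊕ Label q
  | popWhile _ _ _ p => Option (Label p)

theorem finite_label : ∀ p : StackProg K Γ σ, Finite (Label p)
  | push _ _ => inferInstanceAs (Finite Empty)
  | pop _ _ => inferInstanceAs (Finite Empty)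
  | load _ => inferInstanceAs (Finite Empty)
  | seq p q =>
    have := finite_label p
    have := finite_label q
    inferInstanceAs (Finite (Label p ⊕ Label q))
  | ite _ p q =>
    have := finite_label p
    have := finite_label q
    inferInstanceAs (Finite (Label p ⊕ Label q))
  | popWhile _ _ _ p =>
    have := finite_label p
    inferInstanceAs (Finite (Option (Label p)))

/-- The machine statement that runs a program and continues with the statement `s`. The labels of
the program are named by `ι`. -/
def stmt {Λ : Type} : (p : StackProg K Γ σ) → (Label p → Λ) → Turing.TM2.Stmt Γ Λ σ →
    Turing.TM2.Stmt Γ Λ σ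
  | push k a, _, s => .push k a s
  | pop k f, _, s => .pop k f s
  | load f, _, s => .load f s
  | seq p q, ι, s => stmt p (fun l => ι (.inl l)) (stmt q (fun l => ι (.inr l)) s)
  | ite c p q, ι, s => .branch c (stmt p (fun l => ι (.inl l)) s) (stmt q (fun l => ι (.inr l)) s)
  | popWhile _ _ _ _, ι, _ => .goto fun _ => ι none

/-- The statements attached to the labels of a program that is followed by the statement `s`. -/
def table {Λ : Type} : (p : StackProg K Γ σ) → (Label p → Λ) → Turing.TM2.Stmt Γ Λ σ →
    Label p → Turing.TM2.Stmt Γ Λ σ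
  | push _ _, _, _, l => Empty.elim l
  | pop _ _, _, _, l => Empty.elim l
  | load _, _, _, l => Empty.elim l
  | seq p q, ι, s, .inl l =>
    table p (fun l => ι (.inl l)) (stmt q (fun l => ι (.inr l)) s) l
  | seq _ q, ι, s, .inr l => table q (fun l => ι (.inr l)) s l
  | ite _ p _, ι, s, .inl l => table p (fun l => ι (.inl l)) s l
  | ite _ _ q, ι, s, .inr l => table q (fun l => ι (.inr l)) s l
  | popWhile k f c p, ι, s, none =>
    .pop k f (.branch c (stmt p (fun l => ι (some l)) (.goto fun _ => ι none)) s)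
  | popWhile _ _ _ p, ι, _, some l => table p (fun l => ι (some l)) (.goto fun _ => ι none) l

variable [DecidableEq K]

/-- `Run p v S t v' S'`: started with register `v` and stacks `S`, the program `p` ends with
register `v'` and stacks `S'`, entering the head of a loop at most `t` times. -/
inductive Run : StackProg K Γ σ → σ → (∀ k, List (Γ k)) → ℕ → σ → (∀ k, List (Γ k)) → Prop
  | push {k a v S t} : Run (push k a) v S t v (Function.update S k (a v :: S k))
  | pop {k f v S t} : Run (pop k f) v S t (f v (S k).head?) (Function.update S k (S k).tail)
  | load {f v S t} : Run (load f) v S t (f v) S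
  | seq {p q v S t v' S' t' v'' S'' T} : Run p v S t v' S' → Run q v' S' t' v'' S'' →
      t + t' ≤ T → Run (seq p q) v S T v'' S''
  | ite_true {c p q v S t v' S'} : c v = true → Run p v S t v' S' → Run (ite c p q) v S t v' S'
  | ite_false {c p q v S t v' S'} : c v = false → Run q v S t v' S' → Run (ite c p q) v S t v' S'
  | leave {k f c p v S T} : c (f v (S k).head?) = false → 1 ≤ T →
      Run (popWhile k f c p) v S T (f v (S k).head?) (Function.update S k (S k).tail)
  | loop {k f c p v S t v' S' t' v'' S'' T} : c (f v (S k).head?) = true →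
      Run p (f v (S k).head?) (Function.update S k (S k).tail) t v' S' →
      Run (popWhile k f c p) v' S' t' v'' S'' → t + 1 + t' ≤ T →
      Run (popWhile k f c p) v S T v'' S''

theorem Run.mono
    {p : StackProg K Γ σ} {v : σ} {S : ∀ k, List (Γ k)} {t : ℕ} {v' : σ} {S' : ∀ k, List (Γ k)}
    {T : ℕ} (h : p.Run v S t v' S') (hT : t ≤ T) : p.Run v S T v' S' := by
  induction h generalizing T with
  | push => exact .push
  | pop => exact .pop
  | load => exact .load
  | seq h₁ h₂ h => exact .seq h₁ h₂ (h.trans hT)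
  | ite_true hc _ ih => exact .ite_true hc (ih hT)
  | ite_false hc _ ih => exact .ite_false hc (ih hT)
  | leave hc h => exact .leave hc (h.trans hT)
  | loop hc h₁ h₂ h => exact .loop hc h₁ h₂ (h.trans hT)

/-- Configurations are iterated in `Option`, so that `none` stands for a machine that has halted. -/
theorem iterate_bind_trans {α : Type*} {f : α → Option α} {a b : α} {c : Option α} {m n : ℕ}
    (h : (flip bind f)^[m] (some a) = some b) (h' : (flip bind f)^[n] (some b) = c) :
    (flip bind f)^[n + m] (some a) = c := by
  rw [Function.iterate_add_apply, h, h']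

/-- The compiled machine does what the program does. A machine may execute any statement without
jumps in one step, so that only the entries into loop heads count. -/
theorem Run.iterate_step {p : StackProg K Γ σ} {v S t v' S'} (h : Run p v S t v' S')
    {Λ : Type} (m : Λ → Turing.TM2.Stmt Γ Λ σ) (ι : Label p → Λ) (s : Turing.TM2.Stmt Γ Λ σ)
    (hm : ∀ l, m (ι l) = table p ι s l) :
    ∃ n ≤ t, (flip bind (Turing.TM2.step m))^[n] (some (Turing.TM2.stepAux (stmt p ι s) v S)) =
      some (Turing.TM2.stepAux s v' S') := by
  induction h generalizing s with
  | push => exact ⟨0, Nat.zero_le _, rfl⟩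
  | pop => exact ⟨0, Nat.zero_le _, rfl⟩
  | load => exact ⟨0, Nat.zero_le _, rfl⟩
  | @seq p q _ _ _ _ _ _ _ _ _ _ _ hT ih₁ ih₂ =>
    obtain ⟨n₁, h₁, e₁⟩ := ih₁ (fun l => ι (.inl l)) (stmt q (fun l => ι (.inr l)) s)
      fun l => hm (.inl l)
    obtain ⟨n₂, h₂, e₂⟩ := ih₂ (fun l => ι (.inr l)) s fun l => hm (.inr l)
    exact ⟨n₂ + n₁, by omega, iterate_bind_trans e₁ e₂⟩
  | ite_true hc _ ih =>
    obtain ⟨n, h, e⟩ := ih (fun l => ι (.inl l)) s fun l => hm (.inl l)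
    exact ⟨n, h, by simpa [stmt, hc] using e⟩
  | ite_false hc _ ih =>
    obtain ⟨n, h, e⟩ := ih (fun l => ι (.inr l)) s fun l => hm (.inr l)
    exact ⟨n, h, by simpa [stmt, hc] using e⟩
  | leave hc hT =>
    refine ⟨1, hT, ?_⟩
    have := hm none
    simp [stmt, flip, this, table, hc]
  | @loop k f c p v S t v' S' t' v'' S'' T hc _ _ hT ih₁ ih₂ =>
    obtain ⟨n₁, h₁, e₁⟩ := ih₁ (fun l => ι (some l)) (.goto fun _ => ι none)
      fun l => hm (some l)
    obtain ⟨n₂, h₂, e₂⟩ := ih₂ ι s hm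
    refine ⟨n₂ + (n₁ + 1), by omega, iterate_bind_trans (iterate_bind_trans ?_ e₁) e₂⟩
    have := hm none
    simp [stmt, flip, this, table, hc]

/-- The Turing machine that runs a program and resets its register. -/
noncomputable def machine [Fintype K] [Fintype σ] (p : StackProg K Γ σ) (k₀ k₁ : K)
    [Fintype (Γ k₀)] (v₀ : σ) : Turing.FinTM2 where
  K := K
  k₀ := k₀
  k₁ := k₁
  Γ := Γ
  Λ := Option (Label p)
  main := none
  ΛFin := by
    have := finite_label p
    exact Fintype.ofFinite _
  σ := σ
  initialState := v₀
  m l := l.elim (stmt p some (.load (fun _ => v₀) .halt))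
    (table p some (.load (fun _ => v₀) .halt))

/-- The time of a run bounds the steps of the machine, with one more step for the jump to the start
label. -/
theorem iterate_step_machine [Fintype K] [Fintype σ] {p : StackProg K Γ σ} {k₀ k₁ : K}
    [Fintype (Γ k₀)] {v₀ : σ} {S S' v' t} (h : Run p v₀ S t v' S') :
    ∃ n ≤ t + 1, (flip bind (machine p k₀ k₁ v₀).step)^[n]
      (some (⟨some none, v₀, S⟩ : Turing.TM2.Cfg Γ (Option (Label p)) σ)) =
      some (⟨none, v₀, S'⟩ : Turing.TM2.Cfg Γ (Option (Label p)) σ) := by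
  obtain ⟨n, hn, e⟩ := h.iterate_step (machine p k₀ k₁ v₀).m some (.load (fun _ => v₀) .halt)
    fun _ => rfl
  exact ⟨n + 1, by omega, iterate_bind_trans (m := 1) rfl e⟩

end StackProg

/-! ### Memory of the reduction machine -/

namespace Reduction

/-- The unary counters: the size `n`, two counters that split a range into the part before and the
part after the current index, the number of input bits in `P` and `Q`, the exponents of the two
coordinates of a grade, and a temporary. -/
inductive Ctr : Type
  | size | before | after | area | xexp | yexp | temp
  deriving DecidableEq

instance : Fintype Ctr where
  elems := {.size, .before, .after, .area, .xexp, .yexp, .temp}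
  complete c := by cases c <;> decide

/-- The stacks. The four stacks `str (s, r)` hold streams of offsets: `s` tells for which of the
two modules, `r` whether for its generators or for its relations. -/
inductive Stack : Type
  | inp | out | str (p : Bool × Bool) | ctr (c : Ctr)
  deriving DecidableEq, Fintype

/-- The alphabets of the stacks. A stream of offsets holds pairs of bits, and `none` marks the
beginning of a slot. -/
@[reducible] def Alph (F : Type) : Stack → Type
  | .inp => Bool
  | .out => GMSymbol F
  | .str _ => Option (Bool × Bool)
  | .ctr _ => Unit

/-- The register: whether the last pop was successful, and the last offset that was popped. -/
abbrev Reg : Type := Bool × Option (Bool × Bool)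

/-- The effect of a pop on the register. Popping a counter does not change the offset. -/
def popReg (F : Type) : (k : Stack) → Reg → Option (Alph F k) → Reg
  | .inp, _, x => (x.isSome, x.map fun b => (b, false))
  | .out, v, _ => v
  | .str _, _, x => (x.isSome, x.join)
  | .ctr _, v, x => (x.isSome, v.2)

/-- The contents of the stacks, the counters being numbers. -/
structure Mem (F : Type) where
  inp : List Bool
  out : List (GMSymbol F)
  str : Bool × Bool → List (Option (Bool × Bool))
  size : ℕ
  before : ℕ
  after : ℕ
  area : ℕ
  xexp : ℕ
  yexp : ℕ
  temp : ℕ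

namespace Mem

variable {F : Type}

/-- The value of a counter. -/
def get (m : Mem F) : Ctr → ℕ
  | .size => m.size
  | .before => m.before
  | .after => m.after
  | .area => m.area
  | .xexp => m.xexp
  | .yexp => m.yexp
  | .temp => m.temp

/-- Changing the value of a counter. -/
def set (m : Mem F) (c : Ctr) (j : ℕ) : Mem F :=
  match c with
  | .size => { m with size := j }
  | .before => { m with before := j }
  | .after => { m with after := j }
  | .area => { m with area := j }
  | .xexp => { m with xexp := j }
  | .yexp => { m with yexp := j }
  | .temp => { m with temp := j }

/-- The stacks that represent a memory. -/
def stk (m : Mem F) : (k : Stack) → List (Alph F k)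
  | .inp => m.inp
  | .out => m.out
  | .str p => m.str p
  | .ctr c => List.replicate (m.get c) ()

theorem stk_update_inp (m : Mem F) (l : List Bool) :
    Function.update m.stk .inp l = { m with inp := l }.stk := by
  funext k
  cases k with
  | ctr c => cases c <;> rfl
  | _ => rfl

theorem stk_update_out (m : Mem F) (l : List (GMSymbol F)) :
    Function.update m.stk .out l = { m with out := l }.stk := by
  funext k
  cases k with
  | ctr c => cases c <;> rfl
  | _ => rfl

theorem stk_update_str (m : Mem F) (p : Bool × Bool) (l : List (Option (Bool × Bool))) :
    Function.update m.stk (.str p) l = { m with str := Function.update m.str p l }.stk := by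
  funext k
  cases k with
  | ctr c => cases c <;> rfl
  | str q =>
    by_cases h : q = p
    · subst h
      rw [Function.update_self]
      exact (Function.update_self q l m.str).symm
    · rw [Function.update_of_ne (by simpa using h)]
      exact (Function.update_of_ne h l m.str).symm
  | _ => rfl

theorem get_set_self (m : Mem F) (c : Ctr) (j : ℕ) : (m.set c j).get c = j := by
  cases c <;> rfl

theorem get_set_of_ne (m : Mem F) {c d : Ctr} (h : d ≠ c) (j : ℕ) :
    (m.set c j).get d = m.get d := by
  cases c <;> cases d <;> first | rfl | exact absurd rfl h

theorem set_eq_self {m : Mem F} {c : Ctr} {j : ℕ} (h : m.get c = j) : m.set c j = m := by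
  subst h
  cases c <;> rfl

theorem set_set (m : Mem F) (c : Ctr) (i j : ℕ) : (m.set c i).set c j = m.set c j := by
  cases c <;> rfl

theorem set_comm (m : Mem F) {c d : Ctr} (h : c ≠ d) (i j : ℕ) :
    (m.set c i).set d j = (m.set d j).set c i := by
  cases c <;> cases d <;> first | rfl | exact absurd rfl h

theorem stk_update_ctr (m : Mem F) (c : Ctr) (j : ℕ) :
    Function.update m.stk (.ctr c) (List.replicate j ()) = (m.set c j).stk := by
  funext k
  cases k with
  | ctr d =>
    by_cases h : d = c
    · subst h
      rw [Function.update_self]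
      simp only [stk, get_set_self]
    · rw [Function.update_of_ne (by simpa using h)]
      simp only [stk, get_set_of_ne _ h]
  | _ => cases c <;> rfl

end Mem

/-- Programs on the stacks of the reduction. -/
abbrev Code (F : Type) : Type := StackProg Stack (Alph F) Reg

/-- `Does p v m t v' m'`: the program `p` turns the memory `m` into `m'` and the offset `v` in the
register into `v'` within time `t`. -/
def Does {F : Type} (p : Code F) (v : Option (Bool × Bool)) (m : Mem F) (t : ℕ)
    (v' : Option (Bool × Bool)) (m' : Mem F) : Prop :=
  ∀ b, ∃ b', StackProg.Run p (b, v) m.stk t (b', v') m'.stk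

/-! ### Building blocks of the reduction machine -/

section Blocks

variable {F : Type}

/-- Write a symbol of the output. As the output is written from its end, the last symbol comes
first. -/
def write (a : Option (Bool × Bool) → GMSymbol F) : Code F := .push .out fun v => a v.2

/-- Increase a counter. -/
def inc (c : Ctr) : Code F := .push (.ctr c) fun _ => ()

/-- Decrease a counter. -/
def dec (c : Ctr) : Code F := .pop (.ctr c) (popReg F _)

/-- Count a counter down to zero, running `p` each time. -/
def countdown (c : Ctr) (p : Code F) : Code F := .popWhile (.ctr c) (popReg F _) (fun v => v.1) p

/-- Run `p` as often as the counter `c` says. The counter is restored in the end. -/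
def times (c : Ctr) (p : Code F) : Code F :=
  .seq (countdown c (.seq (inc .temp) p)) (countdown .temp (inc c))

/-- Clear the offset in the register. -/
def forget : Code F := .load fun v => (v.1, none)

variable {p q : Code F} {v v' v'' : Option (Bool × Bool)} {m m' m'' : Mem F} {t t' T : ℕ}

theorem Does.mono (h : Does p v m t v' m') (hT : t ≤ T) : Does p v m T v' m' :=
  fun b => (h b).imp fun _ h => h.mono hT

theorem Does.seq (h : Does p v m t v' m') (h' : Does q v' m' t' v'' m'') :
    Does (.seq p q) v m (t + t') v'' m'' := fun b =>
  let ⟨b', hb⟩ := h b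
  let ⟨b'', hb'⟩ := h' b'
  ⟨b'', .seq hb hb' le_rfl⟩

theorem does_write (a : Option (Bool × Bool) → GMSymbol F) :
    Does (write a) v m 0 v { m with out := a v :: m.out } := fun b =>
  ⟨b, by rw [← Mem.stk_update_out m (a v :: m.out)]; exact .push⟩

theorem does_inc (c : Ctr) : Does (F := F) (inc c) v m 0 v (m.set c (m.get c + 1)) := fun b =>
  ⟨b, by rw [← Mem.stk_update_ctr]; exact StackProg.Run.push (K := Stack)⟩

theorem does_dec {c : Ctr} {j : ℕ} (h : m.get c = j + 1) :
    Does (F := F) (dec c) v m 0 v (m.set c j) := fun b =>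
  ⟨true, by
    have : m.stk (.ctr c) = List.replicate (j + 1) () := by rw [← h]; rfl
    rw [← Mem.stk_update_ctr]
    have h' : StackProg.Run (dec c) (b, v) m.stk 0 _ _ := .pop
    rw [this] at h'
    exact h'⟩

theorem does_forget : Does (F := F) forget v m 0 none m := fun b => ⟨b, .load⟩

theorem does_countdown_zero {c : Ctr} (h : m.get c = 0) :
    Does (countdown c p) v m 1 v m := fun b =>
  ⟨false, by
    have e : m.stk (.ctr c) = [] := by
      have : m.stk (.ctr c) = List.replicate (m.get c) () := rfl
      rw [this, h]; rfl
    have h' : StackProg.Run (countdown c p) (b, v) m.stk 1 _ _ := .leave (by rw [e]; rfl) le_rfl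
    rw [e] at h'
    have e' : Function.update m.stk (.ctr c) [] = m.stk := by
      rw [← e, Function.update_eq_self]
    rw [List.tail_nil, e'] at h'
    exact h'⟩

theorem does_countdown_succ {c : Ctr} {j : ℕ} (h : m.get c = j + 1)
    (hp : Does p v (m.set c j) t v' m') (hr : Does (countdown c p) v' m' t' v'' m'') :
    Does (countdown c p) v m (t + 1 + t') v'' m'' := fun b => by
  have e : m.stk (.ctr c) = List.replicate (j + 1) () := by rw [← h]; rfl
  obtain ⟨b', hb⟩ := hp true
  obtain ⟨b'', hb'⟩ := hr b'
  refine ⟨b'', .loop (t := t) (v' := (b', v')) (S' := m'.stk) ?_ ?_ hb' le_rfl⟩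
  · rw [e]; rfl
  · rw [e]
    rw [← Mem.stk_update_ctr] at hb
    exact hb

/-- The rule for loops: `M i` is the memory after `i` rounds. -/
theorem does_countdown {c : Ctr} {N : ℕ} (M : ℕ → Mem F) (hM : ∀ i, (M i).get c = N - i)
    (h : ∀ i < N, Does p v ((M i).set c (N - (i + 1))) t v (M (i + 1))) :
    Does (countdown c p) v (M 0) ((t + 1) * N + 1) v (M N) := by
  -- induction on the number `j` of remaining rounds
  suffices H : ∀ j ≤ N, Does (countdown c p) v (M (N - j)) ((t + 1) * j + 1) v (M N) by
    simpa using H N le_rfl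
  intro j
  induction j with
  | zero => exact fun _ => by simpa using does_countdown_zero (by rw [hM]; simp)
  | succ j ih =>
    intro hj
    have h₁ := h (N - (j + 1)) (by omega)
    have e₁ : N - (j + 1) + 1 = N - j := by omega
    have e₂ : N - (N - j) = j := by omega
    rw [e₁, e₂] at h₁
    refine (does_countdown_succ ?_ h₁ (ih (by omega))).mono (by ring_nf; omega)
    rw [hM]
    omega

/-- Adding a counter to another one, which clears it. -/
theorem does_transfer {c d : Ctr} (hcd : c ≠ d) :
    Does (F := F) (countdown c (inc d)) v m (m.get c + 1) v
      ((m.set c 0).set d (m.get d + m.get c)) := by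
  have := does_countdown (p := inc d) (v := v) (t := 0) (c := c) (N := m.get c)
    (fun i => (m.set c (m.get c - i)).set d (m.get d + i))
    (fun i => by rw [Mem.get_set_of_ne _ hcd, Mem.get_set_self]) (fun i _ => by
      have h := does_inc (F := F) (v := v) (m := ((m.set c (m.get c - i)).set d
        (m.get d + i)).set c (m.get c - (i + 1))) d
      rw [Mem.get_set_of_ne _ hcd.symm, Mem.get_set_self, Mem.set_comm _ hcd.symm, Mem.set_set,
        Mem.set_set] at h
      rw [Mem.set_comm _ hcd.symm, Mem.set_set]
      exact h)
  have h0 : (m.set c (m.get c - 0)).set d (m.get d + 0) = m := by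
    rw [Nat.sub_zero, Nat.add_zero, Mem.set_eq_self rfl, Mem.set_eq_self rfl]
  simp only [h0, Nat.sub_self] at this
  exact this.mono (by omega)

/-- The rule for `times`: `M i` is the memory after `i` rounds. -/
theorem does_times {c : Ctr} (hc : c ≠ .temp) {N : ℕ} (M : ℕ → Mem F)
    (hM : ∀ i, (M i).get c = N) (hM' : ∀ i, (M i).temp = 0)
    (h : ∀ i < N, Does p v (((M i).set c (N - (i + 1))).set .temp (i + 1)) t v
      (((M (i + 1)).set c (N - (i + 1))).set .temp (i + 1))) :
    Does (times c p) v (M 0) ((t + 2) * N + 2) v (M N) := by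
  have h₁ := does_countdown (p := .seq (inc .temp) p) (v := v) (c := c) (N := N) (t := t)
    (fun i => ((M i).set c (N - i)).set .temp i)
    (fun i => by rw [Mem.get_set_of_ne _ hc, Mem.get_set_self]) (fun i hi => by
      have h' := does_inc (F := F) (v := v)
        (m := (((M i).set c (N - i)).set .temp i).set c (N - (i + 1))) .temp
      rw [Mem.get_set_of_ne _ hc.symm, Mem.get_set_self, Mem.set_comm _ hc.symm, Mem.set_set,
        Mem.set_set] at h'
      rw [Mem.set_comm _ hc.symm, Mem.set_set]
      exact (h'.seq (h i hi)).mono (by omega))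
  have h₂ := does_transfer (F := F) (v := v) (m := ((M N).set c (N - N)).set .temp N) hc.symm
  have e (i : ℕ) : ((M i).set c N).set .temp 0 = M i := by
    rw [Mem.set_eq_self (hM i), Mem.set_eq_self (c := .temp) (hM' i)]
  have e₁ : (((((M N).set c (N - N)).set .temp N).set .temp 0).set c
      (((((M N).set c (N - N)).set .temp N).get c) +
        ((((M N).set c (N - N)).set .temp N).get .temp))) = M N := by
    rw [Mem.get_set_of_ne _ hc, Mem.get_set_self, Mem.get_set_self, Mem.set_set,
      Mem.set_comm _ hc.symm, Mem.set_set, Nat.sub_self, Nat.zero_add, e]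
  rw [e₁, Mem.get_set_self] at h₂
  simp only [Nat.sub_zero, e] at h₁
  exact (h₁.seq h₂).mono (by ring_nf; omega)

end Blocks

variable {F : Type} {v v' v'' : Option (Bool × Bool)} {m m' m'' : Mem F} {t t' T : ℕ}

/-! ### Writing words and grades -/

/-- Write a word in front of the output. -/
def writeWord : List (GMSymbol F) → Code F
  | [] => .load id
  | a :: w => .seq (writeWord w) (write fun _ => a)

theorem does_writeWord : ∀ w : List (GMSymbol F),
    Does (writeWord w) v m 0 v { m with out := w ++ m.out }
  | [] => fun b => ⟨b, .load⟩
  | a :: w => (does_writeWord w).seq (does_write fun _ => a)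

theorem does_writeTimes {c : Ctr} (hc : c ≠ .temp) (h : m.temp = 0) (a : GMSymbol F) :
    Does (times c (write fun _ => a)) v m (2 * m.get c + 2) v
      { m with out := List.replicate (m.get c) a ++ m.out } := by
  have := does_times (v := v) (t := 0) (p := write fun _ => a) hc (N := m.get c)
    (fun i => { m with out := List.replicate i a ++ m.out }) (fun i => by cases c <;> rfl)
    (fun i => h) (fun i _ => by
      have := does_write (F := F) (v := v)
        (m := (({ m with out := List.replicate i a ++ m.out } : Mem F).set c
          (m.get c - (i + 1))).set .temp (i + 1)) fun _ => a
      cases c <;> exact this)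
  exact this.mono (by omega)

/-- The symbol of a bit. -/
abbrev bit (b : Bool) : GMSymbol F := .bit b

/-- The word for the grade with first coordinate `o.1 + 2 * o.2 + 2 ^ (x + 2)` and second coordinate
`2 ^ y`. -/
def gradeWord (x y : ℕ) (o : Bool × Bool) : List (GMSymbol F) :=
  bit false :: bit o.1 :: bit o.2 :: (List.replicate x (bit false) ++ ([bit true, .comma] ++
    bit false :: (List.replicate y (bit false) ++ [bit true, .comma])))

/-- Write a grade with the offset in the register, with `d` added to the second exponent. -/
def writeGrade (d : ℕ) : Code F :=
  .seq (writeWord (List.replicate d (bit false) ++ [bit true, .comma]))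
  (.seq (times .yexp (write fun _ => bit false))
  (.seq (writeWord ([bit true, .comma] ++ [bit false]))
  (.seq (times .xexp (write fun _ => bit false))
  (.seq (write fun o => bit (o.elim false Prod.snd))
  (.seq (write fun o => bit (o.elim false Prod.fst)) (write fun _ => bit false))))))

theorem does_writeGrade (d : ℕ) (o : Bool × Bool) {i w S n b a ar x y} :
    Does (F := F) (writeGrade d) (some o) ⟨i, w, S, n, b, a, ar, x, y, 0⟩ (2 * (x + y) + 4) (some o)
      ⟨i, gradeWord x (y + d) o ++ w, S, n, b, a, ar, x, y, 0⟩ := by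
  have hw (u : List (GMSymbol F)) {w : List (GMSymbol F)} : Does (writeWord u) (some o)
    ⟨i, w, S, n, b, a, ar, x, y, 0⟩ 0 (some o) ⟨i, u ++ w, S, n, b, a, ar, x, y, 0⟩ :=
    does_writeWord u
  have h1 {w : List (GMSymbol F)} : Does (times .yexp (write fun _ => bit false)) (some o)
    ⟨i, w, S, n, b, a, ar, x, y, 0⟩ (2 * y + 2) (some o)
    ⟨i, List.replicate y (bit false) ++ w, S, n, b, a, ar, x, y, 0⟩ :=
    does_writeTimes (by decide) rfl _
  have h2 {w : List (GMSymbol F)} : Does (times .xexp (write fun _ => bit false)) (some o)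
    ⟨i, w, S, n, b, a, ar, x, y, 0⟩ (2 * x + 2) (some o)
    ⟨i, List.replicate x (bit false) ++ w, S, n, b, a, ar, x, y, 0⟩ :=
    does_writeTimes (by decide) rfl _
  have h3 (g : Option (Bool × Bool) → GMSymbol F) {w : List (GMSymbol F)} : Does (write g) (some o)
    ⟨i, w, S, n, b, a, ar, x, y, 0⟩ 0 (some o) ⟨i, g (some o) :: w, S, n, b, a, ar, x, y, 0⟩ :=
    does_write g
  have := (hw (w := w) (List.replicate d (bit false) ++ [bit true, .comma])).seq
    (h1.seq ((hw ([bit true, .comma] ++ [bit false])).seq (h2.seq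
    ((h3 fun o => bit (o.elim false Prod.snd)).seq
    ((h3 fun o => bit (o.elim false Prod.fst)).seq (h3 fun _ => bit false))))))
  have e : gradeWord x (y + d) o ++ w = bit false :: bit o.1 :: bit o.2 ::
      (List.replicate x (bit false) ++ (([bit true, .comma] ++ [bit false]) ++
      (List.replicate y (bit false) ++
      ((List.replicate d (bit false) ++ [bit true, .comma]) ++ w)))) := by
    rw [gradeWord, List.replicate_add]
    simp only [List.cons_append, List.append_assoc, List.nil_append]
  rw [e]
  exact this.mono (by omega)

/-! ### Writing the grades of a stream -/

/-- Empty a stream of offsets, running `p` for each of its entries. -/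
def popStream (s : Bool × Bool) (p : Code F) : Code F :=
  .popWhile (.str s) (popReg F _) (fun v => v.1) p

theorem does_popStream_nil {s : Bool × Bool} {p : Code F} (h : m.str s = []) :
    Does (popStream s p) v m 1 none m := fun b =>
  ⟨false, by
    have h' : StackProg.Run (popStream s p) (b, v) m.stk 1 _ _ :=
      .leave (by rw [show m.stk (.str s) = [] from h]; rfl) le_rfl
    have e' : Function.update m.stk (.str s) [] = m.stk := by
      rw [← show m.stk (.str s) = [] from h, Function.update_eq_self]
    rw [show m.stk (.str s) = [] from h, List.tail_nil, e'] at h'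
    exact h'⟩

theorem does_popStream_cons {s : Bool × Bool} {p : Code F} {x l i w S n b a ar xe ye z}
    (h : S s = x :: l)
    (hp : Does p x ⟨i, w, Function.update S s l, n, b, a, ar, xe, ye, z⟩ t v' m')
    (hr : Does (popStream s p) v' m' t' v'' m'') :
    Does (popStream s p) v ⟨i, w, S, n, b, a, ar, xe, ye, z⟩ (t + 1 + t') v'' m'' := fun c => by
  have e : (⟨i, w, S, n, b, a, ar, xe, ye, z⟩ : Mem F).stk (.str s) = x :: l := h
  obtain ⟨b', hb⟩ := hp true
  obtain ⟨b'', hb'⟩ := hr b'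
  refine ⟨b'', .loop (t := t) (v' := (b', v')) (S' := m'.stk) ?_ ?_ hb' le_rfl⟩
  · rw [e]; rfl
  · rw [e]
    rw [← Mem.stk_update_str ⟨i, w, S, n, b, a, ar, xe, ye, z⟩ s l] at hb
    exact hb

/-- Write the grades with the offsets in a stream. The marker at the beginning of a slot moves on
to the previous slot. -/
def writeStream (s : Bool × Bool) (d : ℕ) : Code F :=
  popStream s (.ite (fun v => v.2.isSome) (writeGrade d) (.seq (dec .xexp) (inc .yexp)))

theorem Does.ite_true {p q : Code F} {c : Reg → Bool} (hc : ∀ b, c (b, v) = true)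
    (h : Does p v m t v' m') : Does (.ite c p q) v m t v' m' := fun b =>
  (h b).imp fun _ h => .ite_true (hc b) h

theorem Does.ite_false {p q : Code F} {c : Reg → Bool} (hc : ∀ b, c (b, v) = false)
    (h : Does q v m t v' m') : Does (.ite c p q) v m t v' m' := fun b =>
  (h b).imp fun _ h => .ite_false (hc b) h

/-- Writing a stream, split at the last slot: after the entries `c` of this slot have been written,
the rest `l` of the stream is left. -/
theorem does_writeStream_slot {s : Bool × Bool} {d : ℕ} {l : List (Option (Bool × Bool))}
    {i n b a ar x y} :
    ∀ (c : List (Bool × Bool)) {v : Option (Bool × Bool)} {w S}, S s = c.map some ++ l →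
    (∀ v, Does (writeStream s d) v ⟨i, c.reverse.flatMap (gradeWord x (y + d)) ++ w,
      Function.update S s l, n, b, a, ar, x, y, 0⟩ t v' m') →
    Does (F := F) (writeStream s d) v ⟨i, w, S, n, b, a, ar, x, y, 0⟩
      ((2 * (x + y) + 5) * c.length + t) v' m'
  | [], v, w, S, hs, h => by
    have := h v
    rw [List.map_nil, List.nil_append] at hs
    rw [← hs, Function.update_eq_self] at this
    simpa using this
  | o :: c, v, w, S, hs, h => by
    refine (does_popStream_cons hs (Does.ite_true (fun _ => rfl) (does_writeGrade d o))
      (does_writeStream_slot c (Function.update_self ..) fun v => ?_)).mono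
      (by simp only [List.length_cons]; ring_nf; omega)
    have := h v
    simp only [List.reverse_cons, List.flatMap_append, List.flatMap_cons, List.flatMap_nil,
      List.append_nil, List.append_assoc] at this
    rwa [Function.update_idem]

/-- The contents of a stream with slots `S 0, …, S (N - 1)`, the last one being on top. -/
def streamOf (N : ℕ) (S : ℕ → List (Bool × Bool)) : List (Option (Bool × Bool)) :=
  ((List.range N).flatMap fun i => none :: (S i).map some).reverse

/-- The grades with the offsets `S i` in the slots `i < N`. -/
def gradesOf (N : ℕ) (S : ℕ → List (Bool × Bool)) (x y : ℕ) : List (GMSymbol F) :=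
  (List.range N).flatMap fun i => (S i).flatMap (gradeWord (i + 1 + x) (N - 1 - i + y))

theorem gradesOf_succ (N : ℕ) (S : ℕ → List (Bool × Bool)) (x y : ℕ) :
    gradesOf (F := F) (N + 1) S x y =
      gradesOf N S x (y + 1) ++ (S N).flatMap (gradeWord (N + 1 + x) y) := by
  rw [gradesOf, List.range_succ, List.flatMap_append, gradesOf]
  congr 1
  · refine List.flatMap_congr fun i hi => ?_
    have := List.mem_range.1 hi
    rw [show N - 1 - i + (y + 1) = N + 1 - 1 - i + y by omega]
  · simp

theorem does_writeStream {s : Bool × Bool} {d n₀ : ℕ} {S : ℕ → List (Bool × Bool)}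
    (hS : ∀ i, (S i).length = n₀) (x₀ : ℕ) {i n b a ar} :
    ∀ (N : ℕ) {v : Option (Bool × Bool)} {w G x y}, G s = streamOf N S → x = N + x₀ →
    Does (F := F) (writeStream s d) v ⟨i, w, G, n, b, a, ar, x, y, 0⟩
      (((2 * (x + y) + 5) * n₀ + 1) * N + 1) none
      ⟨i, gradesOf N S x₀ (y + d) ++ w, Function.update G s [], n, b, a, ar, x₀, y + N, 0⟩
  | 0, v, w, G, x, y, hs, hx => by
    have hs' : G s = [] := hs
    rw [← hs', Function.update_eq_self]
    rw [Nat.zero_add] at hx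
    rw [← hx]
    exact (does_popStream_nil hs').mono (by omega)
  | N + 1, v, w, G, x, y, hs, hx => by
    have hs' : G s = (S N).reverse.map some ++ none :: streamOf N S := by
      rw [hs]; simp [streamOf, List.range_succ]
    have ih := does_writeStream (d := d) (i := i) (n := n) (b := b) (a := a) (ar := ar) hS x₀ N
      (v := none) (w := (S N).flatMap (gradeWord x (y + d)) ++ w)
      (G := Function.update G s (streamOf N S)) (y := y + 1) (Function.update_self ..) rfl
    refine (does_writeStream_slot (t := ((2 * (x + y) + 5) * n₀ + 1) * N + 2) (S N).reverse hs'
      fun v => ?_).mono ?_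
    · have hm := (does_dec (F := F) (v := none) (m := ⟨i, (S N).reverse.reverse.flatMap
        (gradeWord x (y + d)) ++ w, Function.update (Function.update G s (none :: streamOf N S)) s
        (streamOf N S), n, b, a, ar, x, y, 0⟩) (c := .xexp) (j := N + x₀)
        (hx.trans (by omega))).seq (does_inc .yexp)
      rw [List.reverse_reverse] at hm ⊢
      refine (does_popStream_cons (Function.update_self ..) (Does.ite_false (fun _ => rfl) hm)
        (t' := ((2 * (x + y) + 5) * n₀ + 1) * N + 1) ?_).mono (by omega)
      rw [Function.update_idem] at ih ⊢
      rw [gradesOf_succ, List.append_assoc, show y + (N + 1) = y + 1 + N by omega,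
        show y + d + 1 = y + 1 + d by omega, show N + 1 + x₀ = x from hx.symm]
      rw [show N + x₀ + (y + 1) = x + y by omega] at ih
      exact ih
    · rw [List.length_reverse, hS]
      ring_nf
      omega

/-! ### Building the streams of offsets -/

/-- The streams after the word `w` has been pushed onto both streams of the module `s`. -/
def append (S : Bool × Bool → List (Option (Bool × Bool))) (s : Bool)
    (w : List (Option (Bool × Bool))) : Bool × Bool → List (Option (Bool × Bool)) :=
  fun p => if p.1 = s then w.reverse ++ S p else S p

theorem append_append (S : Bool × Bool → List (Option (Bool × Bool))) (s : Bool)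
    (w w' : List (Option (Bool × Bool))) :
    append (append S s w) s w' = append S s (w ++ w') := by
  funext p
  by_cases h : p.1 = s <;> simp [append, h]

theorem append_nil (S : Bool × Bool → List (Option (Bool × Bool))) (s : Bool) :
    append S s [] = S := by
  funext p
  by_cases h : p.1 = s <;> simp [append, h]

/-- Push an entry onto both streams of the module `s`. -/
def pushBoth (s : Bool) (x : Option (Bool × Bool) → Option (Bool × Bool)) : Code F :=
  .seq (.push (.str (s, false)) fun v => x v.2) (.push (.str (s, true)) fun v => x v.2)

theorem does_pushStr (s : Bool × Bool) (f : Option (Bool × Bool) → Option (Bool × Bool))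
    {i w S n b a ar x y z} :
    Does (F := F) (.push (.str s) fun v => f v.2) v ⟨i, w, S, n, b, a, ar, x, y, z⟩ 0 v
      ⟨i, w, Function.update S s (f v :: S s), n, b, a, ar, x, y, z⟩ := fun c =>
  ⟨c, by
    rw [← Mem.stk_update_str ⟨i, w, S, n, b, a, ar, x, y, z⟩ s (f v :: S s)]
    exact .push⟩

theorem does_pushBoth (s : Bool) (f : Option (Bool × Bool) → Option (Bool × Bool))
    {i w S n b a ar x y z} :
    Does (F := F) (pushBoth s f) v ⟨i, w, S, n, b, a, ar, x, y, z⟩ 0 v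
      ⟨i, w, append S s [f v], n, b, a, ar, x, y, z⟩ := by
  have e : append S s [f v] = Function.update (Function.update S (s, false) (f v :: S (s, false)))
      (s, true) (f v :: S (s, true)) := by
    funext ⟨p, q⟩
    by_cases hp : p = s
    · subst hp
      cases q <;> simp [append]
    · simp [append, hp]
  rw [e]
  have := (does_pushStr (F := F) (v := v) (s, false) f (i := i) (w := w) (S := S) (n := n) (b := b)
    (a := a) (ar := ar) (x := x) (y := y) (z := z)).seq (does_pushStr (s, true) f)
  rwa [Function.update_of_ne (show (s, true) ≠ (s, false) by simp)] at this

/-- Move an input bit, together with the first bit `true`, to the streams of the module `s`. -/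
def copyBit (s : Bool) : Code F :=
  .seq (.pop .inp (popReg F _)) (.seq (pushBoth s fun v => some (true, v.elim false Prod.fst))
    (.seq (inc .area) forget))

theorem does_copyBit (s : Bool) {c i w S n b a ar x y z} :
    Does (F := F) (copyBit s) v ⟨c :: i, w, S, n, b, a, ar, x, y, z⟩ 0 none
      ⟨i, w, append S s [some (true, c)], n, b, a, ar + 1, x, y, z⟩ := by
  have h : Does (F := F) (.pop .inp (popReg F _)) v ⟨c :: i, w, S, n, b, a, ar, x, y, z⟩ 0
      (some (c, false)) ⟨i, w, S, n, b, a, ar, x, y, z⟩ := fun d => ⟨true, by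
    rw [← Mem.stk_update_inp ⟨c :: i, w, S, n, b, a, ar, x, y, z⟩ i]
    exact .pop⟩
  exact h.seq ((does_pushBoth s _).seq ((does_inc .area).seq does_forget))

theorem does_copyRow (s : Bool) {r i w S n b a ar x y} (hr : r.length = n) :
    Does (F := F) (times .size (copyBit s)) none ⟨r ++ i, w, S, n, b, a, ar, x, y, 0⟩ (2 * n + 2)
      none ⟨i, w, append S s (r.map fun c => some (true, c)), n, b, a, ar + n, x, y, 0⟩ := by
  have := does_times (F := F) (v := none) (t := 0) (c := .size) (p := copyBit s) (by decide)
    (N := n) (fun j => ⟨r.drop j ++ i, w, append S s ((r.take j).map fun c => some (true, c)), n, b,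
      a, ar + j, x, y, 0⟩) (fun _ => rfl) (fun _ => rfl) (fun j hj => by
      have hj' : j < r.length := hr ▸ hj
      have := does_copyBit (F := F) (v := none) s (c := r[j]) (i := r.drop (j + 1) ++ i) (w := w)
        (S := append S s ((r.take j).map fun c => some (true, c))) (n := n - (j + 1)) (b := b)
        (a := a) (ar := ar + j) (x := x) (y := y) (z := j + 1)
      rw [append_append, ← List.cons_append, ← List.drop_eq_getElem_cons hj'] at this
      rw [show (r.take (j + 1)).map (fun c => some (true, c)) =
        (r.take j).map (fun c => some (true, c)) ++ [some (true, r[j])] by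
          rw [List.take_add_one, List.getElem?_eq_getElem hj', List.map_append]; rfl]
      exact this)
  simp only [List.take_zero, List.drop_zero, List.map_nil, append_nil, Nat.add_zero, ← hr,
    List.take_length, List.drop_length, List.nil_append] at this
  rw [hr] at this
  exact this.mono (by omega)

/-- Run `p` for all ways to split the range of the counter `after` at an index, and reset the
counters. -/
def forSplits (p : Code F) : Code F :=
  .seq (countdown .after (.seq p (inc .before))) (countdown .before (inc .after))

/-- The rule for `forSplits`: `W j` and the like are the contents of the stacks after `j`
rounds. -/
theorem does_forSplits {p : Code F} {N n x y : ℕ} (I : ℕ → List Bool) (W : ℕ → List (GMSymbol F))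
    (S : ℕ → Bool × Bool → List (Option (Bool × Bool))) (A : ℕ → ℕ)
    (h : ∀ j < N, Does p none ⟨I j, W j, S j, n, j, N - (j + 1), A j, x, y, 0⟩ t none
      ⟨I (j + 1), W (j + 1), S (j + 1), n, j, N - (j + 1), A (j + 1), x, y, 0⟩) :
    Does (forSplits p) none ⟨I 0, W 0, S 0, n, 0, N, A 0, x, y, 0⟩ ((t + 2) * N + 2) none
      ⟨I N, W N, S N, n, 0, N, A N, x, y, 0⟩ := by
  have h₁ := does_countdown (F := F) (v := none) (t := t) (c := .after) (N := N)
    (p := .seq p (inc .before)) (fun j => ⟨I j, W j, S j, n, j, N - j, A j, x, y, 0⟩) (fun _ => rfl)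
    fun j hj => (h j hj).seq (does_inc .before)
  have h₂ := does_transfer (F := F) (v := none)
    (m := ⟨I N, W N, S N, n, N, N - N, A N, x, y, 0⟩) (c := .before) (d := .after) (by decide)
  have h₃ := h₁.seq h₂
  simp only [Mem.set, Mem.get, Nat.sub_self, Nat.zero_add, Nat.sub_zero] at h₃
  exact h₃.mono (by ring_nf; omega)

/-- A slot of a stream: its offsets, preceded by a marker. -/
abbrev slot (c : List (Bool × Bool)) : List (Option (Bool × Bool)) := none :: c.map some

/-- Move the rows of a square matrix from the input to the streams of the module `s`. -/
def copyRows (s : Bool) : Code F :=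
  forSplits (.seq (pushBoth s fun _ => none) (times .size (copyBit s)))

theorem flatMap_range_succ_left {α : Type*} (f : ℕ → List α) (n : ℕ) :
    (List.range (n + 1)).flatMap f = f 0 ++ (List.range n).flatMap fun i => f (i + 1) := by
  rw [List.range_succ_eq_map, List.flatMap_cons, List.flatMap_map]

theorem flatMap_range_succ {α : Type*} (f : ℕ → List α) (n : ℕ) :
    (List.range (n + 1)).flatMap f = (List.range n).flatMap f ++ f n := by
  rw [List.range_succ, List.flatMap_append]
  simp

theorem does_copyRows (s : Bool) (R : ℕ → List Bool) {i w S n ar x y}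
    (hR : ∀ j < n, (R j).length = n) :
    Does (F := F) (copyRows s) none
      ⟨(List.range n).flatMap R ++ i, w, S, n, 0, n, ar, x, y, 0⟩ ((2 * n + 4) * n + 2) none
      ⟨i, w, append S s ((List.range n).flatMap fun j => slot ((R j).map (Prod.mk true))), n, 0, n,
        ar + n * n, x, y, 0⟩ := by
  have := does_forSplits (F := F) (t := 2 * n + 2) (N := n) (n := n) (x := x) (y := y)
    (p := .seq (pushBoth s fun _ => none) (times .size (copyBit s)))
    (fun j => (List.range (n - j)).flatMap (fun k => R (j + k)) ++ i) (fun _ => w)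
    (fun j => append S s ((List.range j).flatMap fun j => slot ((R j).map (Prod.mk true))))
    (fun j => ar + n * j) (fun j hj => by
      have h := (does_pushBoth (F := F) (v := none) s (fun _ => none)).seq
        (does_copyRow s (r := R j) (i := (List.range (n - (j + 1))).flatMap
          (fun k => R (j + 1 + k)) ++ i) (w := w) (S := append (append S s
            ((List.range j).flatMap fun j => slot ((R j).map (Prod.mk true)))) s [none])
          (n := n) (b := j) (a := n - (j + 1)) (ar := ar + n * j) (x := x) (y := y) (hR j hj))
      rw [append_append, append_append] at h
      rw [show n - j = n - (j + 1) + 1 by omega, flatMap_range_succ_left, flatMap_range_succ,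
        List.append_assoc, Nat.mul_succ, ← Nat.add_assoc]
      simp only [Nat.add_right_comm j 1] at h
      refine Does.mono ?_ (by omega : 0 + (2 * n + 2) ≤ 2 * n + 2)
      simpa [Function.comp_def, Nat.add_assoc, slot, Nat.add_comm 1] using h)
  rw [copyRows]
  simpa [append_nil, Nat.add_assoc] using this

/-- The entries of row `j` of the matrix with `false` on the diagonal and `true` elsewhere, together
with the first bit `false`. -/
def diagRow (n j : ℕ) : List (Bool × Bool) := (List.range n).map fun k => (false, decide (j ≠ k))

theorem diagRow_eq {n j : ℕ} (hj : j < n) : diagRow n j = List.replicate j (false, true) ++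
    ((false, false) :: List.replicate (n - (j + 1)) (false, true)) := by
  refine List.ext_getElem (by simp [diagRow]; omega) fun k h₁ h₂ => ?_
  simp only [diagRow, List.getElem_map, List.getElem_range]
  rcases lt_trichotomy k j with h | rfl | h
  · rw [List.getElem_append_left (by simpa using h), List.getElem_replicate]
    simp [h.ne']
  · simp
  · rw [List.getElem_append_right (by simpa using h.le), List.getElem_cons]
    simp [h.ne, show k - j ≠ 0 by omega]

/-- Write the row of index `before` of the matrix with `false` on the diagonal and `true` elsewhere
to the streams of the module `s`. -/
def writeDiagRow (s : Bool) : Code F :=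
  .seq (pushBoth s fun _ => none)
    (.seq (times .before (pushBoth s fun _ => some (false, true)))
    (.seq (pushBoth s fun _ => some (false, false))
    (times .after (pushBoth s fun _ => some (false, true)))))

/-- Write all rows of the matrix with `false` on the diagonal and `true` elsewhere to the streams
of the module `s`. -/
def diagRows (s : Bool) : Code F := forSplits (writeDiagRow s)

theorem does_times_pushBoth {c : Ctr} (hc : c ≠ .temp) (s : Bool) (f : Option (Bool × Bool))
    {i w S n b a ar x y} :
    Does (F := F) (times c (pushBoth s fun _ => f)) v ⟨i, w, S, n, b, a, ar, x, y, 0⟩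
      (2 * (⟨i, w, S, n, b, a, ar, x, y, 0⟩ : Mem F).get c + 2) v
      ⟨i, w, append S s (List.replicate ((⟨i, w, S, n, b, a, ar, x, y, 0⟩ : Mem F).get c) f),
        n, b, a, ar, x, y, 0⟩ := by
  have := does_times (v := v) (t := 0) (p := pushBoth s fun _ => f) hc
    (N := (⟨i, w, S, n, b, a, ar, x, y, 0⟩ : Mem F).get c)
    (fun j => ⟨i, w, append S s (List.replicate j f), n, b, a, ar, x, y, 0⟩)
    (fun j => by cases c <;> rfl) (fun _ => rfl) (fun j _ => by
      rw [List.replicate_succ', ← append_append]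
      cases c <;> exact does_pushBoth s _)
  rw [List.replicate_zero, append_nil] at this
  exact this.mono (by omega)

theorem does_diagRows (s : Bool) {i w S n₀ n ar x y} :
    Does (F := F) (diagRows s) none ⟨i, w, S, n₀, 0, n, ar, x, y, 0⟩ ((2 * n + 6) * n + 2) none
      ⟨i, w, append S s ((List.range n).flatMap fun j => slot (diagRow n j)), n₀, 0, n,
        ar, x, y, 0⟩ := by
  have := does_forSplits (F := F) (p := writeDiagRow s) (t := 2 * n + 4) (N := n) (n := n₀)
    (x := x) (y := y) (fun j => i) (fun _ => w)
    (fun j => append S s ((List.range j).flatMap fun j => slot (diagRow n j)))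
    (fun j => ar) (fun j hj => by
      have h := (does_pushBoth (F := F) (v := none) s (fun _ => none) (S := append S s
        ((List.range j).flatMap fun j => slot (diagRow n j)))).seq
        ((does_times_pushBoth (c := .before) (by decide) s (some (false, true)) (i := i) (w := w)
          (n := n₀) (b := j) (a := n - (j + 1)) (ar := ar) (x := x) (y := y)).seq
        ((does_pushBoth s (fun _ => some (false, false))).seq
        (does_times_pushBoth (c := .after) (by decide) s (some (false, true)))))
      simp only [append_append, Mem.get] at h
      rw [flatMap_range_succ, slot, diagRow_eq hj]
      refine Does.mono ?_ (by omega : 0 + (2 * j + 2 + (0 + (2 * (n - (j + 1)) + 2))) ≤ _)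
      simpa [slot, writeDiagRow] using h)
  rw [diagRows]
  simpa [append_nil, Nat.add_assoc] using this

/-! ### Writing the matrix -/

/-- Row `k` of the matrix with `R` rows that has `1` at the places `(k, k)` and `-1` at the places
`(k, k + n)`. -/
def matrixRow (F : Type) [Field F] (n R k : ℕ) : List (GMSymbol F) :=
  List.replicate k (.entry 0) ++ .entry 1 :: (List.replicate (n - 1) (.entry 0) ++
    .entry (-1) :: List.replicate (R - (k + 1)) (.entry 0))

/-- Write the row whose distance from the last one is given by the counter `before`. There are
`n - 1` zeros between the two nonzero entries, so that one of the `n` zeros that have been written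
is removed again. -/
def writeMatrixRow [Field F] : Code F :=
  .seq (times .before (write fun _ => .entry 0)) (.seq (write fun _ => .entry (-1))
    (.seq (times .size (write fun _ => .entry 0)) (.seq (.pop .out (popReg F _))
    (.seq (write fun _ => .entry 1) (times .after (write fun _ => .entry 0))))))

/-- Write the matrix whose number of rows is given by the counter `after`. -/
def writeMatrix [Field F] : Code F := forSplits writeMatrixRow

theorem does_writeMatrix [Field F] {i w S n R ar x y} (hn : 0 < R → 0 < n) :
    Does (F := F) writeMatrix none ⟨i, w, S, n, 0, R, ar, x, y, 0⟩
      ((2 * n + 2 * R + 8) * R + 2) none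
      ⟨i, (List.range R).flatMap (matrixRow F n R) ++ w, S, n, 0, R, ar, x, y, 0⟩ := by
  have := does_forSplits (F := F) (p := writeMatrixRow) (t := 2 * n + 2 * R + 6) (N := R) (n := n)
    (x := x) (y := y) (fun j => i)
    (fun j => (List.range j).flatMap (fun k => matrixRow F n R (R - j + k)) ++ w) (fun j => S)
    (fun j => ar) (fun j hj => by
      obtain ⟨n, rfl⟩ : ∃ k, n = k + 1 := ⟨n - 1, by have := hn (by omega); omega⟩
      have hw (c : Ctr) (hc : c ≠ .temp) (a : GMSymbol F) {w : List (GMSymbol F)} :=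
        does_writeTimes (F := F) (v := none)
          (m := ⟨i, w, S, n + 1, j, R - (j + 1), ar, x, y, 0⟩) hc rfl a
      have hw' (a : GMSymbol F) {w : List (GMSymbol F)} :=
        does_write (F := F) (v := none) (m := ⟨i, w, S, n + 1, j, R - (j + 1), ar, x, y, 0⟩)
          fun _ => a
      have hp (a : GMSymbol F) {w : List (GMSymbol F)} : Does (F := F) (.pop .out (popReg F _)) none
          ⟨i, a :: w, S, n + 1, j, R - (j + 1), ar, x, y, 0⟩ 0 none
          ⟨i, w, S, n + 1, j, R - (j + 1), ar, x, y, 0⟩ := fun d => ⟨d, by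
        rw [← Mem.stk_update_out ⟨i, a :: w, S, n + 1, j, R - (j + 1), ar, x, y, 0⟩ w]
        exact .pop⟩
      have h := (hw .before (by decide) (.entry 0) (w := (List.range j).flatMap
        (fun k => matrixRow F (n + 1) R (R - j + k)) ++ w)).seq
        ((hw' (.entry (-1))).seq ((hw .size (by decide) (.entry 0)).seq
        ((hp (.entry 0)).seq ((hw' (.entry 1)).seq (hw .after (by decide) (.entry 0))))))
      rw [flatMap_range_succ_left]
      simp only [show ∀ k, R - (j + 1) + (k + 1) = R - j + k by omega]
      rw [Nat.add_zero, matrixRow, Nat.add_sub_cancel, show R - (R - (j + 1) + 1) = j by omega]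
      simp only [List.append_assoc, List.cons_append]
      refine Does.mono h ?_
      simp only [Mem.get]
      omega)
  rw [writeMatrix]
  simpa [Nat.add_assoc] using this

/-! ### The reduction machine -/

/-- Read the unary number at the beginning of the input, into the counters `size` and `after`, and
twice this number plus one into the counter `xexp`. -/
def readSize : Code F :=
  .seq (.popWhile .inp (popReg F _) (fun v => v.1 && v.2.elim false Prod.fst)
    (.seq (inc .size) (.seq (inc .after) (.seq (inc .xexp) (inc .xexp)))))
    (.seq forget (inc .xexp))

theorem does_readSize {w S b ar y z} (k : ℕ) {i n a x} :
    Does (F := F) readSize v ⟨List.replicate k true ++ false :: i, w, S, n, b, a, ar, x, y, z⟩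
      (k + 1) none ⟨i, w, S, n + k, b, a + k, ar, x + 2 * k + 1, y, z⟩ := by
  have h : ∀ k n a x v, Does (F := F) (.popWhile .inp (popReg F _)
      (fun v => v.1 && v.2.elim false Prod.fst)
      (.seq (inc .size) (.seq (inc .after) (.seq (inc .xexp) (inc .xexp))))) v
      ⟨List.replicate k true ++ false :: i, w, S, n, b, a, ar, x, y, z⟩ (k + 1)
      (some (false, false)) ⟨i, w, S, n + k, b, a + k, ar, x + 2 * k, y, z⟩ := by
    intro k
    induction k with
    | zero =>
      refine fun n a x v c => ⟨true, ?_⟩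
      rw [List.replicate_zero, List.nil_append]
      have := Mem.stk_update_inp (F := F) ⟨false :: i, w, S, n, b, a, ar, x, y, z⟩ i
      exact this ▸ .leave rfl le_rfl
    | succ k ih =>
      intro n a x v c
      obtain ⟨b₁, h₁⟩ := ((does_inc (F := F) (v := some (true, false))
        (m := ⟨List.replicate k true ++ false :: i, w, S, n, b, a, ar, x, y, z⟩) .size).seq
        ((does_inc .after).seq ((does_inc .xexp).seq (does_inc .xexp)))) true
      obtain ⟨b₂, h₂⟩ := ih (n + 1) (a + 1) (x + 1 + 1) (some (true, false)) b₁
      refine ⟨b₂, ?_⟩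
      rw [show n + (k + 1) = n + 1 + k by omega, show a + (k + 1) = a + 1 + k by omega,
        show x + 2 * (k + 1) = x + 1 + 1 + 2 * k by omega]
      have := Mem.stk_update_inp (F := F) ⟨List.replicate (k + 1) true ++ false :: i, w, S, n, b, a,
        ar, x, y, z⟩ (List.replicate k true ++ false :: i)
      exact .loop rfl (this ▸ h₁) h₂ (by omega)
  exact (h k n a x v).seq (does_forget.seq (does_inc .xexp))

/-- Push a slot with constant offsets onto the stream for the generators of the module `s`. -/
def firstSlot (s : Bool) (o : Bool × Bool) : Code F :=
  .seq (.push (.str (s, false)) fun _ => none)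
    (times .size (.push (.str (s, false)) fun _ => some o))

theorem does_firstSlot (s : Bool) (o : Bool × Bool) {i w S n b a ar x y}
    (hS : S (s, false) = []) :
    Does (F := F) (firstSlot s o) none ⟨i, w, S, n, b, a, ar, x, y, 0⟩ (2 * n + 2) none
      ⟨i, w, Function.update S (s, false) (slot (List.replicate n o)).reverse, n, b, a, ar, x, y,
        0⟩ := by
  have h₁ := does_pushStr (F := F) (v := none) (s, false) (fun _ => none) (i := i) (w := w)
    (S := S) (n := n) (b := b) (a := a) (ar := ar) (x := x) (y := y) (z := 0)
  have h₂ := does_times (F := F) (v := none) (t := 0)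
    (p := .push (.str (s, false)) fun _ => some o) (c := .size) (by decide) (N := n)
    (fun j => ⟨i, w, Function.update S (s, false) (slot (List.replicate j o)).reverse, n, b, a, ar,
      x, y, 0⟩) (fun _ => rfl) (fun _ => rfl) (fun j _ => by
      have := does_pushStr (F := F) (v := none) (s, false) (fun _ => some o) (i := i) (w := w)
        (S := Function.update S (s, false) (slot (List.replicate j o)).reverse) (n := n - (j + 1))
        (b := b) (a := a) (ar := ar) (x := x) (y := y) (z := j + 1)
      rw [Function.update_idem, Function.update_self] at this
      rw [show slot (List.replicate (j + 1) o) = slot (List.replicate j o) ++ [some o] by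
        simp [slot, List.replicate_succ'], List.reverse_append]
      exact this)
  rw [hS] at h₁
  exact (h₁.seq h₂).mono (by omega)

/-- The slots of a module: a constant one, followed by `n` slots given by `A` and `n` slots given
by `B`. -/
def slots (n : ℕ) (o : Bool × Bool) (A B : ℕ → List (Bool × Bool)) (t : ℕ) : List (Bool × Bool) :=
  if t = 0 then List.replicate n o else if t ≤ n then A (t - 1) else B (t - 1 - n)

theorem flatMap_slots (n : ℕ) (o : Bool × Bool) (A B : ℕ → List (Bool × Bool)) :
    ((List.range (2 * n)).flatMap fun t => slot (slots n o A B (t + 1))) =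
      ((List.range n).flatMap fun t => slot (A t)) ++
        (List.range n).flatMap fun t => slot (B t) := by
  rw [two_mul, List.range_add, List.flatMap_append, List.flatMap_map]
  congr 1
  · refine List.flatMap_congr fun t ht => ?_
    have := List.mem_range.1 ht
    rw [slots, if_neg (by omega), if_pos (by omega), Nat.add_sub_cancel]
  · refine List.flatMap_congr fun t ht => ?_
    rw [slots, if_neg (by omega), if_neg (by omega), Nat.add_sub_cancel, Nat.add_sub_cancel_left]

/-- The word that describes a graded matrix with the given slots. -/
def moduleWord (F : Type) [Field F] (n : ℕ) (S : ℕ → List (Bool × Bool)) : List (GMSymbol F) :=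
  gradesOf (2 * n + 1) S 0 2 ++ .semicolon :: (gradesOf (2 * n) (fun t => S (t + 1)) 1 3 ++
    .semicolon :: ((List.range (n * n + n * n)).flatMap (matrixRow F n (n * n + n * n)) ++
      [.semicolon]))

/-- Write the description of the module `s`, from its end. The counter `after` holds the number of
relations, and `xexp` the number of slots. After every stream, the two exponents are reset. -/
def writeModule [Field F] (s : Bool) : Code F :=
  .seq (write fun _ => .semicolon) (.seq writeMatrix (.seq (write fun _ => .semicolon)
    (.seq (writeStream (s, true) 3) (.seq (countdown .yexp (inc .xexp))
    (.seq (write fun _ => .semicolon) (.seq (writeStream (s, false) 2)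
    (countdown .yexp (inc .xexp))))))))

/-- A bound for the running time of `writeModule`. -/
def moduleTime (n : ℕ) : ℕ :=
  (2 * n + 2 * (n * n + n * n) + 8) * (n * n + n * n) + 2 +
    (((2 * (2 * n + 1) + 5) * n + 1) * (2 * n) + 1) + (2 * n + 1) +
    (((2 * (2 * n + 1) + 5) * n + 1) * (2 * n + 1) + 1) + (2 * n + 2)

theorem does_writeModule [Field F] (s : Bool) {n : ℕ} {S : ℕ → List (Bool × Bool)}
    (hS : ∀ i, (S i).length = n) {w G} (h₁ : G (s, true) = streamOf (2 * n) fun t => S (t + 1))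
    (h₀ : G (s, false) = streamOf (2 * n + 1) S) :
    Does (writeModule s) none ⟨[], w, G, n, 0, n * n + n * n, 0, 2 * n + 1, 0, 0⟩ (moduleTime n)
      none ⟨[], moduleWord F n S ++ w,
        Function.update (Function.update G (s, true) []) (s, false) [], n, 0, n * n + n * n, 0,
        2 * n + 1, 0, 0⟩ := by
  have hw (a : GMSymbol F) {w G} := does_write (F := F) (v := none)
    (m := ⟨[], w, G, n, 0, n * n + n * n, 0, 2 * n + 1, 0, 0⟩) fun _ => a
  have ht (j : ℕ) {w G x} := does_transfer (F := F) (v := none)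
    (m := ⟨[], w, G, n, 0, n * n + n * n, 0, x, j, 0⟩) (c := .yexp) (d := .xexp) (by decide)
  have hr := does_writeStream (F := F) (s := (s, true)) (d := 3) (fun i => hS (i + 1)) 1 (i := [])
    (n := n) (b := 0) (a := n * n + n * n) (ar := 0) (2 * n) (v := none) (G := G) (y := 0)
    (w := .semicolon :: ((List.range (n * n + n * n)).flatMap (matrixRow F n (n * n + n * n)) ++
      .semicolon :: w)) h₁ rfl
  have ht' := ht (2 * n) (w := gradesOf (2 * n) (fun t => S (t + 1)) 1 (0 + 3) ++ .semicolon ::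
    ((List.range (n * n + n * n)).flatMap (matrixRow F n (n * n + n * n)) ++ .semicolon :: w))
    (x := 1) (G := Function.update G (s, true) [])
  have hg := does_writeStream (F := F) (s := (s, false)) (d := 2) hS 0 (i := [])
    (n := n) (b := 0) (a := n * n + n * n) (ar := 0) (2 * n + 1) (v := none)
    (G := Function.update G (s, true) []) (y := 0) (w := .semicolon ::
      (gradesOf (2 * n) (fun t => S (t + 1)) 1 3 ++
      .semicolon :: ((List.range (n * n + n * n)).flatMap (matrixRow F n (n * n + n * n)) ++
      .semicolon :: w))) (by rw [Function.update_of_ne (by simp), h₀]) rfl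
  simp only [Mem.set, Mem.get, Nat.zero_add] at ht ht' hr hg
  rw [Nat.add_comm 1] at ht'
  have := (hw .semicolon (w := w) (G := G)).seq
    ((does_writeMatrix (by intro h; by_contra h'; simp_all)).seq
    ((hw .semicolon).seq (hr.seq (ht'.seq ((hw .semicolon).seq (hg.seq
      (ht (2 * n + 1) (x := 0))))))))
  have e : moduleWord F n S ++ w = gradesOf (2 * n + 1) S 0 2 ++ .semicolon ::
      (gradesOf (2 * n) (fun t => S (t + 1)) 1 3 ++
      .semicolon :: ((List.range (n * n + n * n)).flatMap (matrixRow F n (n * n + n * n)) ++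
      .semicolon :: w)) := by
    simp only [moduleWord, List.append_assoc, List.cons_append, List.nil_append]
  rw [e]
  rw [Nat.zero_add (2 * n + 1)] at this
  refine Does.mono this ?_
  simp only [moduleTime, Nat.add_zero, Nat.zero_add]
  omega

theorem does_clear {c : Ctr} {N : ℕ} (M : ℕ → Mem F) (hM : ∀ j, (M j).get c = N - j)
    (h : ∀ j, (M j).set c (N - (j + 1)) = M (j + 1)) :
    Does (countdown c forget) none (M 0) (N + 1) none (M N) := by
  have := does_countdown (v := none) (t := 0) M hM (p := forget) fun j _ => by
    rw [h]
    exact does_forget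
  exact this.mono (by omega)

/-- Read the input and build the streams of offsets. -/
def buildStreams (F : Type) : Code F :=
  .seq readSize (.seq (firstSlot false (false, true)) (.seq (firstSlot true (true, false))
  (.seq (diagRows false) (.seq (copyRows true) (.seq (copyRows false) (diagRows true))))))

/-- The program of the reduction. As the output is written from its end, the second module comes
first. In the end all stacks but the output are cleared. -/
def reduction (F : Type) [Field F] : Code F :=
  .seq (buildStreams F) (.seq (countdown .after forget) (.seq (countdown .area (inc .after))
  (.seq (writeModule true) (.seq (writeModule false) (.seq (countdown .size forget)
  (.seq (countdown .after forget) (countdown .xexp forget)))))))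

theorem streamOf_slots (n : ℕ) (o : Bool × Bool) (A B : ℕ → List (Bool × Bool)) :
    streamOf (2 * n + 1) (slots n o A B) = (slot (List.replicate n o) ++
      (((List.range n).flatMap fun t => slot (A t)) ++
        (List.range n).flatMap fun t => slot (B t))).reverse := by
  rw [streamOf, flatMap_range_succ_left, flatMap_slots]
  rfl

theorem streamOf_slots_succ (n : ℕ) (o : Bool × Bool) (A B : ℕ → List (Bool × Bool)) :
    (streamOf (2 * n) fun t => slots n o A B (t + 1)) =
      (((List.range n).flatMap fun t => slot (A t)) ++
        (List.range n).flatMap fun t => slot (B t)).reverse := by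
  rw [streamOf, flatMap_slots]

theorem length_slots {n : ℕ} {o : Bool × Bool} {A B : ℕ → List (Bool × Bool)}
    (hA : ∀ i, (A i).length = n) (hB : ∀ i, (B i).length = n) (i : ℕ) :
    (slots n o A B i).length = n := by
  simp only [slots]
  split_ifs <;> simp [hA, hB]

/-- The slots of the first module. -/
def slotsM (n : ℕ) (Q : ℕ → List Bool) : ℕ → List (Bool × Bool) :=
  slots n (false, true) (diagRow n) fun i => (Q i).map (Prod.mk true)

/-- The slots of the second module. -/
def slotsN (n : ℕ) (P : ℕ → List Bool) : ℕ → List (Bool × Bool) :=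
  slots n (true, false) (fun i => (P i).map (Prod.mk true)) (diagRow n)

theorem does_reduction [Field F] {n : ℕ} {P Q : ℕ → List Bool}
    (hP : ∀ i, (P i).length = n) (hQ : ∀ i, (Q i).length = n) :
    Does (reduction F) none ⟨List.replicate n true ++ false ::
      ((List.range n).flatMap P ++ (List.range n).flatMap Q), [], fun _ => [], 0, 0, 0, 0, 0, 0, 0⟩
      (200 * (n + 1) ^ 4) none
      ⟨[], moduleWord F n (slotsM n Q) ++ moduleWord F n (slotsN n P), fun _ => [],
        0, 0, 0, 0, 0, 0, 0⟩ := by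
  have hd (i : ℕ) : (diagRow n i).length = n := by simp [diagRow]
  have h₁ := does_readSize (F := F) (v := none) (w := []) (S := fun _ => []) (b := 0) (ar := 0)
    (y := 0) (z := 0) n (i := (List.range n).flatMap P ++ (List.range n).flatMap Q) (n := 0)
    (a := 0) (x := 0)
  simp only [Nat.zero_add] at h₁
  have h₂ := (does_firstSlot (F := F) false (false, true) (S := fun _ => []) rfl).seq
    ((does_firstSlot true (true, false) (by simp)).seq ((does_diagRows false).seq
    ((does_copyRows true P fun i _ => hP i).seq ((does_copyRows false Q (i := []) (w := [])
      (ar := 0 + n * n) (x := 2 * n + 1) (y := 0) fun i _ => hQ i).seq (does_diagRows true)))))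
  rw [List.append_nil, Nat.zero_add] at h₂
  -- the streams that have been built
  generalize hG : append (append (append (append (Function.update (Function.update _ _ _) _ _) _ _)
    _ _) _ _) _ _ = G at h₂
  have h₃ := does_clear (F := F) (c := .after) (N := n) (fun j => ⟨[], [], G, n, 0, n - j,
    n * n + n * n, 2 * n + 1, 0, 0⟩) (fun _ => rfl) fun _ => rfl
  have h₄ := does_transfer (F := F) (v := none) (m := ⟨[], [], G, n, 0, n - n, n * n + n * n,
    2 * n + 1, 0, 0⟩) (c := .area) (d := .after) (by decide)
  simp only [Mem.set, Mem.get, Nat.sub_self, Nat.zero_add, Nat.sub_zero] at h₃ h₄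
  have h₅ := does_writeModule (F := F) true (w := []) (G := G) (S := slotsN n P) (n := n)
    (length_slots (by simp [hP]) hd) (by
      rw [slotsN, streamOf_slots_succ, ← hG]; simp [append]) (by
      rw [slotsN, streamOf_slots, ← hG]; simp [append])
  have h₆ := does_writeModule (F := F) false (w := moduleWord F n (slotsN n P) ++ [])
    (G := Function.update (Function.update G (true, true) []) (true, false) []) (S := slotsM n Q)
    (n := n) (length_slots hd (by simp [hQ])) (by
      rw [slotsM, streamOf_slots_succ, ← hG]; simp [append]) (by
      rw [slotsM, streamOf_slots, ← hG]; simp [append])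
  have e : Function.update (Function.update (Function.update (Function.update G (true, true) [])
      (true, false) []) (false, true) []) (false, false) [] = fun _ => [] := by
    funext ⟨a, b⟩
    cases a <;> cases b <;> simp
  rw [List.append_nil, e] at h₆
  rw [List.append_nil] at h₅
  have h₇ := does_clear (F := F) (c := .size) (N := n) (fun j => ⟨[], moduleWord F n (slotsM n Q) ++
    moduleWord F n (slotsN n P), fun _ => [], n - j, 0, n * n + n * n, 0, 2 * n + 1, 0, 0⟩)
    (fun _ => rfl) fun _ => rfl
  have h₈ := does_clear (F := F) (c := .after) (N := n * n + n * n) (fun j => ⟨[],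
    moduleWord F n (slotsM n Q) ++ moduleWord F n (slotsN n P), fun _ => [], 0, 0,
    n * n + n * n - j, 0, 2 * n + 1, 0, 0⟩) (fun _ => rfl) fun _ => rfl
  have h₉ := does_clear (F := F) (c := .xexp) (N := 2 * n + 1) (fun j => ⟨[],
    moduleWord F n (slotsM n Q) ++ moduleWord F n (slotsN n P), fun _ => [], 0, 0,
    0, 0, 2 * n + 1 - j, 0, 0⟩) (fun _ => rfl) fun _ => rfl
  simp only [Nat.sub_self, Nat.sub_zero] at h₇ h₈ h₉
  have h := h₃.seq (h₄.seq (h₅.seq (h₆.seq (h₇.seq (h₈.seq h₉)))))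
  refine Does.mono ((h₁.seq h₂).seq h) ?_
  have h₁ := Nat.zero_le n
  have h₂ := Nat.zero_le (n ^ 2)
  have h₃ := Nat.zero_le (n ^ 3)
  have h₄ := Nat.zero_le (n ^ 4)
  simp only [moduleTime]
  ring_nf
  linarith

end Reduction

namespace Reduction

/-! ### The graded matrices of the reduction -/

/-- The first coordinate of the grade in slot `t` with offset `o`. -/
def xCoord (t : ℕ) (o : Bool × Bool) : ℕ := Nat.bit o.1 (Nat.bit o.2 (2 ^ (t + 1)))

/-- The second coordinate of the grades in slot `t`. -/
def yCoord (n t : ℕ) : ℕ := 2 ^ (2 * n - t + 2)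

/-- The summand `8 * 2 ^ t` identifies the slot, and the offset, at most `3`, is added to it. -/
theorem xCoord_eq (t : ℕ) (o : Bool × Bool) :
    xCoord t o = 8 * 2 ^ t + 2 * o.2.toNat + o.1.toNat := by
  simp only [xCoord, Nat.bit_val, pow_succ]
  ring

theorem xCoord_mono {s t : ℕ} (h : s < t) (o o' : Bool × Bool) : xCoord s o + 5 ≤ xCoord t o' := by
  rw [xCoord_eq, xCoord_eq]
  have h₁ : 2 ^ (s + 1) ≤ 2 ^ t := Nat.pow_le_pow_right (by norm_num) h
  have h₂ : 0 < 2 ^ s := by positivity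
  have := Bool.toNat_le o.1
  have := Bool.toNat_le o.2
  rw [pow_succ] at h₁
  omega

theorem yCoord_anti {n s t : ℕ} (h : s < t) (ht : t ≤ 2 * n) : yCoord n t + 4 ≤ yCoord n s := by
  rw [yCoord, yCoord]
  have h₁ : 2 ^ (2 * n - t + 2 + 1) ≤ 2 ^ (2 * n - s + 2) :=
    Nat.pow_le_pow_right (by norm_num) (by omega)
  have h₂ : 2 ^ 2 ≤ 2 ^ (2 * n - t + 2) := Nat.pow_le_pow_right (by norm_num) (by omega)
  rw [pow_succ] at h₁
  omega

theorem yCoord_anti' (n s t : ℕ) (h : s ≤ t) : yCoord n t ≤ yCoord n s :=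
  Nat.pow_le_pow_right (by norm_num) (by omega)

theorem xCoord_mono' {s t : ℕ} (h : s < t) (o o' : Bool × Bool) : xCoord s o ≤ xCoord t o' :=
  (Nat.le_add_right _ 5).trans (xCoord_mono h o o')

variable (F : Type)

/-- The graded matrix whose generators have, for every slot `t ≤ 2 * n` and every `i < n`, a grade
with offset `o t i`. The generator of `i` in slot `t` has the index `t * n + i`, and the relation
with this index identifies it with the generator of `i` in the next slot. -/
def gradedMatrix [Field F] (n : ℕ) (o : ℕ → ℕ → Bool × Bool) : GradedMatrix ℤ F where
  numGens := (2 * n + 1) * n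
  numRels := 2 * n * n
  gens k := (xCoord (k / n) (o (k / n) (k % n)), yCoord n (k / n))
  rels k := (xCoord (k / n + 1) (o (k / n + 1) (k % n)), yCoord n (k / n))
  matrix k l := if (l : ℕ) = k then 1 else if (l : ℕ) = k + n then -1 else 0
  homogeneous k l h := by
    have hn : 0 < n := Nat.pos_of_ne_zero fun h0 => by
      have := k.2
      simp [h0] at this
    rw [Prod.mk_le_mk, Nat.cast_le, Nat.cast_le]
    by_cases h₁ : (l : ℕ) = k
    · rw [h₁]
      exact ⟨xCoord_mono' (Nat.lt_succ_self _) _ _, le_rfl⟩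
    · by_cases h₂ : (l : ℕ) = k + n
      · rw [h₂, Nat.add_div_right _ hn, Nat.add_mod_right]
        exact ⟨le_rfl, yCoord_anti' _ _ _ (Nat.le_succ _)⟩
      · simp [h₁, h₂] at h

theorem flatMap_finRange {α : Type*} (n : ℕ) (f : ℕ → List α) :
    (List.finRange n).flatMap (fun i : Fin n => f i) = (List.range n).flatMap f := by
  rw [← List.map_coe_finRange_eq_range, List.flatMap_map]

theorem flatMap_range_mul {α : Type*} (m n : ℕ) (f : ℕ → List α) :
    (List.range (m * n)).flatMap f =
      (List.range m).flatMap fun t => (List.range n).flatMap fun i => f (t * n + i) := by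
  induction m with
  | zero => simp
  | succ m ih =>
    rw [Nat.succ_mul, List.range_add, List.flatMap_append, ih, flatMap_range_succ, List.flatMap_map]

theorem encodeNat_bit (b : Bool) {m : ℕ} (hm : 0 < m) :
    Computability.encodeNat (Nat.bit b m) = b :: Computability.encodeNat m := by
  obtain ⟨p, hp⟩ : ∃ p : PosNum, (m : Num) = .pos p := by
    cases h : (m : Num) with
    | zero =>
      have := Num.to_of_nat m
      rw [h] at this
      exact absurd this.symm hm.ne'
    | pos p => exact ⟨p, rfl⟩
  have hm' : (p : ℕ) = m := by
    have := Num.to_of_nat m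
    rwa [hp] at this
  cases b
  · have : ((Nat.bit false m : ℕ) : Num) = .pos (.bit0 p) := by
      rw [← Num.to_nat_inj, Num.to_of_nat]
      simp [Nat.bit_val, hm', two_mul]
    rw [Computability.encodeNat, this, Computability.encodeNat, hp]
    rfl
  · have : ((Nat.bit true m : ℕ) : Num) = .pos (.bit1 p) := by
      rw [← Num.to_nat_inj, Num.to_of_nat]
      simp [Nat.bit_val, hm', two_mul]
    rw [Computability.encodeNat, this, Computability.encodeNat, hp]
    rfl

theorem encodeNat_two_pow (k : ℕ) :
    Computability.encodeNat (2 ^ k) = List.replicate k false ++ [true] := by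
  induction k with
  | zero => rfl
  | succ k ih =>
    rw [show 2 ^ (k + 1) = Nat.bit false (2 ^ k) by simp [Nat.bit_val, pow_succ, mul_comm],
      encodeNat_bit _ (by positivity), ih, List.replicate_succ, List.cons_append]

theorem encodeInt_natCast (k : ℕ) :
    encodeInt F k = bit false :: ((Computability.encodeNat k).map bit ++ [.comma]) := by
  simp [encodeInt]

theorem encodeGrade_eq (t y : ℕ) (o : Bool × Bool) :
    encodeGrade F ((xCoord t o : ℕ), ((2 ^ y : ℕ) : ℤ)) = gradeWord (t + 1) y o := by
  rw [encodeGrade, encodeInt_natCast, encodeInt_natCast, encodeNat_two_pow, xCoord,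
    encodeNat_bit _ (by simp [Nat.bit_val]), encodeNat_bit _ (by positivity), encodeNat_two_pow]
  simp [gradeWord]

variable [Field F]

theorem flatMap_encodeGrade_gens (n : ℕ) (o : ℕ → ℕ → Bool × Bool) :
    (List.finRange (gradedMatrix F n o).numGens).flatMap
        (fun j => encodeGrade F ((gradedMatrix F n o).gens j)) =
      gradesOf (2 * n + 1) (fun t => (List.range n).map (o t)) 0 2 := by
  change (List.finRange ((2 * n + 1) * n)).flatMap (fun k : Fin _ => encodeGrade F
    ((xCoord (k / n) (o (k / n) (k % n)) : ℕ), (yCoord n (k / n) : ℤ))) = _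
  rw [flatMap_finRange _ fun k => encodeGrade F
    ((xCoord (k / n) (o (k / n) (k % n)) : ℕ), (yCoord n (k / n) : ℤ)), flatMap_range_mul, gradesOf]
  refine List.flatMap_congr fun t ht => ?_
  rw [List.flatMap_map]
  refine List.flatMap_congr fun i hi => ?_
  have hi := List.mem_range.1 hi
  rw [Nat.add_comm (t * n), Nat.add_mul_div_right _ _ (by omega), Nat.div_eq_of_lt hi,
    Nat.add_mul_mod_self_right, Nat.mod_eq_of_lt hi, Nat.zero_add, yCoord, encodeGrade_eq,
    Nat.add_sub_cancel, Nat.add_zero]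

theorem flatMap_encodeGrade_rels (n : ℕ) (o : ℕ → ℕ → Bool × Bool) :
    (List.finRange (gradedMatrix F n o).numRels).flatMap
        (fun j => encodeGrade F ((gradedMatrix F n o).rels j)) =
      gradesOf (2 * n) (fun t => (List.range n).map (o (t + 1))) 1 3 := by
  change (List.finRange (2 * n * n)).flatMap (fun k : Fin _ => encodeGrade F
    ((xCoord (k / n + 1) (o (k / n + 1) (k % n)) : ℕ), (yCoord n (k / n) : ℤ))) = _
  rw [flatMap_finRange _ fun k => encodeGrade F ((xCoord (k / n + 1) (o (k / n + 1) (k % n)) : ℕ),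
    (yCoord n (k / n) : ℤ)), flatMap_range_mul, gradesOf]
  refine List.flatMap_congr fun t ht => ?_
  rw [List.flatMap_map]
  refine List.flatMap_congr fun i hi => ?_
  have hi := List.mem_range.1 hi
  have ht := List.mem_range.1 ht
  rw [Nat.add_comm (t * n), Nat.add_mul_div_right _ _ (by omega), Nat.div_eq_of_lt hi,
    Nat.add_mul_mod_self_right, Nat.mod_eq_of_lt hi, Nat.zero_add, yCoord, encodeGrade_eq,
    show 2 * n - t + 2 = 2 * n - 1 - t + 3 by omega]

/-- A row of the matrix, as it is written by the machine. -/
theorem map_entry_matrix (n : ℕ) (o : ℕ → ℕ → Bool × Bool) (k : Fin (gradedMatrix F n o).numRels) :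
    (List.finRange (gradedMatrix F n o).numGens).map
        (fun j => GMSymbol.entry ((gradedMatrix F n o).matrix k j)) =
      matrixRow F n (n * n + n * n) k := by
  have hk : (k : ℕ) < 2 * n * n := k.2
  have hn : 0 < n := Nat.pos_of_ne_zero fun h0 => by simp [h0] at hk
  have e₁ : 2 * n * n = n * n + n * n := by ring
  have e₂ : (2 * n + 1) * n = n * n + n * n + n := by ring
  rw [e₁] at hk
  have hc : (gradedMatrix F n o).numGens = n * n + n * n + n := e₂
  refine List.ext_getElem ?_ fun l h₁ h₂ => ?_
  · simp only [List.length_map, List.length_finRange, matrixRow, List.length_append,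
      List.length_replicate, List.length_cons]
    omega
  · simp only [List.getElem_map, List.getElem_finRange, matrixRow, List.getElem_append,
      List.getElem_cons, List.getElem_replicate, List.length_replicate, gradedMatrix, Fin.val_cast]
    split_ifs <;> first | rfl | omega

theorem encode_gradedMatrix (n : ℕ) (o : ℕ → ℕ → Bool × Bool) :
    (gradedMatrix F n o).encode = moduleWord F n fun t => (List.range n).map (o t) := by
  rw [GradedMatrix.encode, flatMap_encodeGrade_gens, flatMap_encodeGrade_rels, moduleWord]
  simp only [map_entry_matrix]
  rw [flatMap_finRange, ← show 2 * n * n = n * n + n * n by ring]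
  rfl

/-! ### The reduction is computable in polynomial time -/

/-- The entry `(a, i)` of the indicator matrix of `P`. -/
def entryBit {n : ℕ} (P : Finset (Fin n × Fin n)) (a i : ℕ) : Bool :=
  if h : a < n ∧ i < n then decide ((⟨a, h.1⟩, ⟨i, h.2⟩) ∈ P) else false

theorem encodePairs_eq {n : ℕ} (P : Finset (Fin n × Fin n)) :
    encodePairs P = (List.range n).flatMap fun a => (List.range n).map (entryBit P a) := by
  rw [encodePairs, ← flatMap_finRange]
  refine List.flatMap_congr fun a _ => ?_
  rw [← List.map_coe_finRange_eq_range, List.map_map]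
  refine List.map_congr_left fun i _ => ?_
  simp [entryBit]

/-- The offsets of the first module: in the slot of row `a` of `P`, the staircase `a` has
offset `0` and the others have offset `2`; in the slot of row `a` of `Q`, the offset of the
staircase `i` is `3` or `1`, depending on whether `(a, i) ∈ Q`. -/
def offsetM (I : CIInstance) (t i : ℕ) : Bool × Bool :=
  if t = 0 then (false, true) else if t ≤ I.n then (false, decide (t - 1 ≠ i))
  else (true, entryBit I.Q (t - 1 - I.n) i)

/-- The offsets of the second module, with the roles of `P` and `Q` interchanged. -/
def offsetN (I : CIInstance) (t i : ℕ) : Bool × Bool :=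
  if t = 0 then (true, false) else if t ≤ I.n then (true, entryBit I.P (t - 1) i)
  else (false, decide (t - 1 - I.n ≠ i))

theorem slotsM_eq (I : CIInstance) : slotsM I.n (fun a => (List.range I.n).map (entryBit I.Q a)) =
    fun t => (List.range I.n).map (offsetM I t) := by
  funext t
  simp only [slotsM, slots, diagRow]
  split_ifs with h₀ h₁
  · refine List.ext_getElem (by simp) fun k _ _ => ?_
    simp [offsetM, h₀]
  · refine List.map_congr_left fun i _ => ?_
    simp [offsetM, h₀, h₁]
  · rw [List.map_map]
    refine List.map_congr_left fun i _ => ?_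
    simp [offsetM, h₀, h₁]

theorem slotsN_eq (I : CIInstance) : slotsN I.n (fun a => (List.range I.n).map (entryBit I.P a)) =
    fun t => (List.range I.n).map (offsetN I t) := by
  funext t
  simp only [slotsN, slots, diagRow]
  split_ifs with h₀ h₁
  · refine List.ext_getElem (by simp) fun k _ _ => ?_
    simp [offsetN, h₀]
  · rw [List.map_map]
    refine List.map_congr_left fun i _ => ?_
    simp [offsetN, h₀, h₁]
  · refine List.map_congr_left fun i _ => ?_
    simp [offsetN, h₀, h₁]

/-- The pair of graded matrices to which an instance is reduced. -/
def modulePair (I : CIInstance) : GradedMatrix ℤ F × GradedMatrix ℤ F :=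
  (gradedMatrix F I.n (offsetM I), gradedMatrix F I.n (offsetN I))

theorem run_reduction (I : CIInstance) : ∃ v, (reduction F).Run (false, none)
    (Mem.stk ⟨I.encode, [], fun _ => [], 0, 0, 0, 0, 0, 0, 0⟩) (200 * (I.n + 1) ^ 4) v
    (Mem.stk ⟨[], encodeGMPair (modulePair F I), fun _ => [], 0, 0, 0, 0, 0, 0, 0⟩) := by
  obtain ⟨b, h⟩ := does_reduction (F := F) (n := I.n)
    (P := fun a => (List.range I.n).map (entryBit I.P a))
    (Q := fun a => (List.range I.n).map (entryBit I.Q a)) (by simp) (by simp) false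
  rw [slotsM_eq, slotsN_eq, ← encode_gradedMatrix, ← encode_gradedMatrix, ← encodePairs_eq,
    ← encodePairs_eq] at h
  exact ⟨_, h⟩

/-- The input has more than `n` symbols, so that the time bound in terms of `n` yields one in terms
of the length of the input. -/
theorem nonempty_computable [Finite F] : Nonempty
    (Turing.TM2ComputableInPolyTime CIInstance.encode encodeGMPair (modulePair F)) := by
  classical
  let M := StackProg.machine (reduction F) .inp .out (false, none)
  have h (I : CIInstance) : ∃ n ≤ 200 * (I.encode.length + 1) ^ 4 + 1,
      (flip bind M.step)^[n] (some (Turing.initList M I.encode)) =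
        some (Turing.haltList M (encodeGMPair (modulePair F I))) := by
    obtain ⟨v, hv⟩ := run_reduction F I
    obtain ⟨n, hn, e⟩ := StackProg.iterate_step_machine (k₀ := .inp) (k₁ := .out) hv
    have hl : I.n ≤ I.encode.length := by rw [CIInstance.length_encode]; omega
    have hl' : (I.n + 1) ^ 4 ≤ (I.encode.length + 1) ^ 4 := by gcongr
    have e₀ : Turing.initList M I.encode =
        (⟨some none, (false, none), Mem.stk ⟨I.encode, [], fun _ => [], 0, 0, 0, 0, 0, 0, 0⟩⟩ :
          Turing.TM2.Cfg (Alph F) (Option (reduction F).Label) Reg) := by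
      refine Turing.TM2.Cfg.mk.injEq .. ▸ ⟨rfl, rfl, funext fun k => ?_⟩
      cases k with
      | ctr c => cases c <;> rfl
      | _ => rfl
    have e₁ : Turing.haltList M (encodeGMPair (modulePair F I)) = (⟨none, (false, none),
        Mem.stk ⟨[], encodeGMPair (modulePair F I), fun _ => [], 0, 0, 0, 0, 0, 0, 0⟩⟩ :
          Turing.TM2.Cfg (Alph F) (Option (reduction F).Label) Reg) := by
      refine Turing.TM2.Cfg.mk.injEq .. ▸ ⟨rfl, rfl, funext fun k => ?_⟩
      cases k with
      | ctr c => cases c <;> rfl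
      | _ => rfl
    rw [e₀, e₁]
    exact ⟨n, by omega, e⟩
  choose n hn e using h
  refine ⟨{
    tm := M
    inputAlphabet := Equiv.refl _
    outputAlphabet := Equiv.refl _
    time := 200 * (Polynomial.X + 1) ^ 4 + 1
    outputsFun := fun I => {
      steps := n I
      evals_in_steps := ?_
      steps_le_m := ?_ } }⟩
  · have h₀ : I.encode.map (Equiv.refl Bool).invFun = I.encode := List.map_id _
    have h₁ : (encodeGMPair (modulePair F I)).map (Equiv.refl (GMSymbol F)).invFun =
      encodeGMPair (modulePair F I) := List.map_id _
    have h₂ : ∀ l l', l = I.encode → l' = encodeGMPair (modulePair F I) →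
        (flip bind M.step)^[n I] (some (Turing.initList M l)) = some (Turing.haltList M l') := by
      rintro _ _ rfl rfl
      exact e I
    exact h₂ _ _ h₀ h₁
  · simpa using hn I

end Reduction

/-! ### Interleavings of sums of staircase modules -/

namespace PersistenceModule

variable {F : Type u} [Field F]

/-- An interleaving, with the maps into the shifts written as maps to the translated points. -/
theorem interleaved_iff {M N : PersistenceModule F} {ε : ℝ≥0} :
    Interleaved M N ε ↔ ∃ (f : ∀ p, M.obj p →ₗ[F] N.obj (translate p ε))
      (g : ∀ p, N.obj p →ₗ[F] M.obj (translate p ε)),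
      (∀ {p q : ℝ × ℝ} (h : p ≤ q) (x : M.obj p),
        N.map (translate_mono h ε) (f p x) = f q (M.map h x)) ∧
      (∀ {p q : ℝ × ℝ} (h : p ≤ q) (x : N.obj p),
        M.map (translate_mono h ε) (g p x) = g q (N.map h x)) ∧
      (∀ (p : ℝ × ℝ) (x : M.obj p), g (translate p ε) (f p x) =
        M.map ((le_translate p ε.2).trans (le_translate (translate p ε) ε.2)) x) ∧
      (∀ (p : ℝ × ℝ) (y : N.obj p), f (translate p ε) (g p y) =
        N.map ((le_translate p ε.2).trans (le_translate (translate p ε) ε.2)) y) := by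
  constructor
  · rintro ⟨f, g, hf, hg⟩
    exact ⟨f.app, g.app, fun h x => LinearMap.congr_fun (f.naturality h) x,
      fun h x => LinearMap.congr_fun (g.naturality h) x, hf, hg⟩
  · rintro ⟨f, g, nf, ng, hf, hg⟩
    exact ⟨⟨f, fun h => LinearMap.ext (nf h)⟩, ⟨g, fun h => LinearMap.ext (ng h)⟩, hf, hg⟩

/-- Interleavings can be transported along isomorphisms. -/
theorem Interleaved.of_isomorphic {M M' N N' : PersistenceModule F} {ε : ℝ≥0}
    (hM : M.Isomorphic M') (hN : N.Isomorphic N') (h : Interleaved M' N' ε) :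
    Interleaved M N ε := by
  obtain ⟨a, ha⟩ := hM
  obtain ⟨b, hb⟩ := hN
  obtain ⟨f, g, nf, ng, hf, hg⟩ := interleaved_iff.1 h
  have na {p q : ℝ × ℝ} (h : p ≤ q) (x : M.obj p) : M'.map h (a.app p x) = a.app q (M.map h x) :=
    LinearMap.congr_fun (a.naturality h) x
  have nb {p q : ℝ × ℝ} (h : p ≤ q) (x : N.obj p) : N'.map h (b.app p x) = b.app q (N.map h x) :=
    LinearMap.congr_fun (b.naturality h) x
  let a' p : M.obj p ≃ₗ[F] M'.obj p := LinearEquiv.ofBijective (a.app p) (ha p)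
  let b' p : N.obj p ≃ₗ[F] N'.obj p := LinearEquiv.ofBijective (b.app p) (hb p)
  have ea p (x : M'.obj p) : a.app p ((a' p).symm x) = x := (a' p).apply_symm_apply x
  have eb p (x : N'.obj p) : b.app p ((b' p).symm x) = x := (b' p).apply_symm_apply x
  refine interleaved_iff.2 ⟨fun p => (b' (translate p ε)).symm.toLinearMap ∘ₗ f p ∘ₗ a.app p,
    fun p => (a' (translate p ε)).symm.toLinearMap ∘ₗ g p ∘ₗ b.app p, fun h x => (hb _).1 ?_,
    fun h x => (ha _).1 ?_, fun p x => (ha _).1 ?_, fun p x => (hb _).1 ?_⟩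
  all_goals simp only [LinearMap.comp_apply, LinearEquiv.coe_coe]
  · rw [← nb, eb, eb, nf, na]
  · rw [← na, ea, ea, ng, nb]
  · rw [ea, eb, hf, na]
    rfl
  · rw [eb, ea, hg, nb]
    rfl

theorem Isomorphic.symm {M N : PersistenceModule F} (h : M.Isomorphic N) : N.Isomorphic M := by
  obtain ⟨a, ha⟩ := h
  let a' p : M.obj p ≃ₗ[F] N.obj p := LinearEquiv.ofBijective (a.app p) (ha p)
  have ea p (x : N.obj p) : a.app p ((a' p).symm x) = x := (a' p).apply_symm_apply x
  refine ⟨⟨fun p => (a' p).symm.toLinearMap, fun {p q} h => LinearMap.ext fun x => (ha _).1 ?_⟩,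
    fun p => (a' p).symm.bijective⟩
  have na : N.map h (a.app p ((a' p).symm x)) = a.app q (M.map h ((a' p).symm x)) :=
    LinearMap.congr_fun (a.naturality h) ((a' p).symm x)
  change a.app q (M.map h ((a' p).symm x)) = a.app q ((a' q).symm (N.map h x))
  rw [← na, ea, ea]

theorem interleaved_congr {M M' N N' : PersistenceModule F} {ε : ℝ≥0}
    (hM : M.Isomorphic M') (hN : N.Isomorphic N') : Interleaved M N ε ↔ Interleaved M' N' ε :=
  ⟨.of_isomorphic hM.symm hN.symm, .of_isomorphic hM hN⟩

/-- A sum of staircases is interval decomposable. -/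
theorem IsSumOfStaircases.intervalDecomposable {M : PersistenceModule F} {k : ℕ}
    (h : M.IsSumOfStaircases k) : M.IntervalDecomposable :=
  let ⟨C, hC, h⟩ := h
  ⟨k, fun i => staircase (C i), fun i => isPlaneInterval_staircase (hC i), h⟩

end PersistenceModule

section Staircases

open PersistenceModule

variable {F : Type u} [Field F]

theorem staircase_upper {C : Finset (ℝ × ℝ)} {p q : ℝ × ℝ} (hp : p ∈ staircase C) (h : p ≤ q) :
    q ∈ staircase C :=
  let ⟨a, ha, hap⟩ := hp
  ⟨a, ha, hap.trans h⟩

theorem intervalMap_staircase {C : Finset (ℝ × ℝ)} {p q : ℝ × ℝ} (h : p ≤ q)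
    (x : intervalFiber F (staircase C) p) :
    (intervalMap F (staircase C) p q x : F) = x := by
  by_cases hp : p ∈ staircase C
  · exact if_pos ⟨hp, staircase_upper hp h⟩
  · rw [x.2 hp]
    exact if_neg fun h => hp h.1

/-- The direct sum of the staircase modules of the sets `C i`. -/
noncomputable abbrev staircaseSum (F : Type u) [Field F] {n : ℕ} (C : Fin n → Finset (ℝ × ℝ))
    (hC : ∀ i, (C i).Nonempty) : PersistenceModule F :=
  directSum fun i => staircaseModule F (C i) (hC i)

variable {n : ℕ} {C D : Fin n → Finset (ℝ × ℝ)} {hC : ∀ i, (C i).Nonempty}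
  {hD : ∀ i, (D i).Nonempty}

/-- The coordinates of an element of a sum of staircase modules. -/
def coords {p : ℝ × ℝ} (x : (staircaseSum F C hC).obj p) (i : Fin n) : F :=
  (Subtype.val : intervalFiber F (staircase (C i)) p → F) (x i)

theorem coords_ext {p : ℝ × ℝ} {x y : (staircaseSum F C hC).obj p}
    (h : ∀ i, coords x i = coords y i) : x = y :=
  funext fun i => Subtype.ext (h i)

theorem coords_map {p q : ℝ × ℝ} (h : p ≤ q) (x : (staircaseSum F C hC).obj p) (i : Fin n) :
    coords ((staircaseSum F C hC).map h x) i = coords x i :=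
  intervalMap_staircase h _

theorem coords_eq_zero {p : ℝ × ℝ} (x : (staircaseSum F C hC).obj p) {i : Fin n}
    (h : p ∉ staircase (C i)) : coords x i = 0 :=
  (x i : intervalFiber F (staircase (C i)) p).2 h

/-- The element of a sum of staircase modules with given coordinates. -/
def ofCoords {p : ℝ × ℝ} (c : Fin n → F) (h : ∀ i, p ∉ staircase (C i) → c i = 0) :
    (staircaseSum F C hC).obj p :=
  fun i => (⟨c i, h i⟩ : intervalFiber F (staircase (C i)) p)

/-- The map of a matrix with entries `0` outside the pairs of staircases where the second one
contains a translate of the first one. -/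
def mapOfMatrix (ε : ℝ≥0) (A : Matrix (Fin n) (Fin n) F)
    (hA : ∀ i j, A i j ≠ 0 → ∀ p ∈ staircase (C i), translate p ε ∈ staircase (D j)) (p : ℝ × ℝ) :
    (staircaseSum F C hC).obj p →ₗ[F] (staircaseSum F D hD).obj (translate p ε) where
  toFun x := ofCoords (fun j => ∑ i, coords x i * A i j) fun j hj =>
    Finset.sum_eq_zero fun i _ => by
      by_cases h : A i j = 0
      · rw [h, mul_zero]
      · rw [coords_eq_zero x fun hp => hj (hA i j h p hp), zero_mul]
  map_add' x y := coords_ext fun j => by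
    change ∑ i, (coords x i + coords y i) * A i j = ∑ i, coords x i * A i j +
      ∑ i, coords y i * A i j
    simp only [add_mul, Finset.sum_add_distrib]
  map_smul' c x := coords_ext fun j => by
    change ∑ i, (c * coords x i) * A i j = c * ∑ i, coords x i * A i j
    simp only [Finset.mul_sum, mul_assoc]

/-- The basis vector of the summand `i` at a point `p` of the corresponding staircase. -/
def basisVec (hC : ∀ i, (C i).Nonempty) {p : ℝ × ℝ} {i : Fin n} (hp : p ∈ staircase (C i)) :
    (staircaseSum F C hC).obj p :=
  ofCoords (Pi.single i 1) fun k hk => Pi.single_eq_of_ne (by rintro rfl; exact hk hp) _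

theorem map_basisVec {p q : ℝ × ℝ} {i : Fin n} (hp : p ∈ staircase (C i)) (h : p ≤ q) :
    (staircaseSum F C hC).map h (basisVec hC hp) = basisVec hC (staircase_upper hp h) :=
  coords_ext fun k => coords_map h _ k

/-- The matrix entries of a morphism to a shift do not depend on the point. -/
theorem coords_hom {ε : ℝ≥0}
    {f : ∀ p, (staircaseSum F C hC).obj p →ₗ[F] (staircaseSum F D hD).obj (translate p ε)}
    (hf : ∀ {p q : ℝ × ℝ} (h : p ≤ q) (x : (staircaseSum F C hC).obj p),
      (staircaseSum F D hD).map (translate_mono h ε) (f p x) =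
        f q ((staircaseSum F C hC).map h x))
    {p q : ℝ × ℝ} {i : Fin n} (hp : p ∈ staircase (C i)) (hq : q ∈ staircase (C i)) (j : Fin n) :
    coords (f p (basisVec hC hp)) j = coords (f q (basisVec hC hq)) j := by
  have h {p q : ℝ × ℝ} (hp : p ∈ staircase (C i)) (h : p ≤ q) :
      coords (f p (basisVec hC hp)) j = coords (f q (basisVec hC (staircase_upper hp h))) j := by
    rw [← map_basisVec hp h, ← hf h, coords_map]
  -- both points lie below their supremum
  rw [h hp le_sup_left, h hq le_sup_right]

/-- The coordinates of an element of a sum of staircase modules, as a linear map. -/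
def coordsHom (C : Fin n → Finset (ℝ × ℝ)) (hC : ∀ i, (C i).Nonempty) (p : ℝ × ℝ) :
    (staircaseSum F C hC).obj p →ₗ[F] (Fin n → F) where
  toFun x := coords x
  map_add' _ _ := rfl
  map_smul' _ _ := rfl

/-- At a point of all staircases, a linear map acts on coordinates by its matrix. -/
theorem coords_apply {p q : ℝ × ℝ} (hp : ∀ i, p ∈ staircase (C i))
    (f : (staircaseSum F C hC).obj p →ₗ[F] (staircaseSum F D hD).obj q)
    (x : (staircaseSum F C hC).obj p) (j : Fin n) :
    coords (f x) j = ∑ i, coords x i * coords (f (basisVec (F := F) hC (hp i))) j := by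
  have hx : x = ∑ i, coords x i • basisVec (F := F) hC (hp i) := by
    refine coords_ext fun k => ?_
    have h := map_sum (coordsHom C hC p) (fun i => coords x i • basisVec (F := F) hC (hp i))
      Finset.univ
    simp only [map_smul] at h
    refine Eq.trans ?_ (congrFun h k).symm
    rw [Finset.sum_apply]
    change _ = ∑ i, coords x i * (Pi.single i 1 : Fin n → F) k
    simp [Pi.single_apply]
  have h := map_sum (coordsHom D hD q ∘ₗ f) (fun i => coords x i • basisVec (F := F) hC (hp i))
    Finset.univ
  simp only [map_smul] at h
  rw [← hx] at h
  refine (congrFun h j).trans ?_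
  rw [Finset.sum_apply]
  rfl

/-- Two sums of `n` staircase modules are `ε`-interleaved if and only if there are two mutually
inverse matrices that vanish at those pairs of staircases where the second one does not contain the
translate of the first one. -/
theorem interleaved_staircaseSum_iff (hC : ∀ i, (C i).Nonempty) (hD : ∀ i, (D i).Nonempty)
    (ε : ℝ≥0) :
    Interleaved (staircaseSum F C hC) (staircaseSum F D hD) ε ↔
      ∃ A B : Matrix (Fin n) (Fin n) F,
        (∀ i j, A i j ≠ 0 → ∀ p ∈ staircase (C i), translate p ε ∈ staircase (D j)) ∧
        (∀ i j, B i j ≠ 0 → ∀ p ∈ staircase (D i), translate p ε ∈ staircase (C j)) ∧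
        A * B = 1 := by
  constructor
  · intro h
    obtain ⟨f, g, nf, ng, hfg, -⟩ := interleaved_iff.1 h
    have hC' := hC
    have hD' := hD
    choose a ha using hC'
    choose b hb using hD'
    -- a point in all staircases, where both modules are `F ^ n`
    obtain ⟨P, hP⟩ := Finite.exists_le fun i => a i ⊔ b i
    have hPC i : P ∈ staircase (C i) := ⟨a i, ha i, le_sup_left.trans (hP i)⟩
    have hPD i : translate P ε ∈ staircase (D i) :=
      ⟨b i, hb i, le_sup_right.trans ((hP i).trans (le_translate P ε.2))⟩
    refine ⟨fun i j => coords (f P (basisVec hC (hPC i))) j,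
      fun i j => coords (g (translate P ε) (basisVec hD (hPD i))) j,
      fun i j h p hp => ?_, fun i j h p hp => ?_, ?_⟩
    · by_contra hp'
      exact h ((coords_hom nf (hPC i) hp j).trans (coords_eq_zero _ hp'))
    · by_contra hp'
      exact h ((coords_hom ng (hPD i) hp j).trans (coords_eq_zero _ hp'))
    · ext i k
      have h := congrArg (fun x => coords x k) (hfg P (basisVec hC (hPC i)))
      rw [coords_apply hPD] at h
      replace h := h.trans (coords_map _ _ k)
      refine h.trans ?_
      change (Pi.single i 1 : Fin n → F) k = _
      simp [Pi.single_apply, Matrix.one_apply, eq_comm]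
  · rintro ⟨A, B, hA, hB, hAB⟩
    have hBA : B * A = 1 := mul_eq_one_comm.1 hAB
    have key {A B : Matrix (Fin n) (Fin n) F} (h : A * B = 1) (c : Fin n → F) (k : Fin n) :
        ∑ j, (∑ i, c i * A i j) * B j k = c k := by
      have := congrFun (Matrix.vecMul_vecMul c A B) k
      rw [h, Matrix.vecMul_one] at this
      exact this
    refine interleaved_iff.2 ⟨mapOfMatrix ε A hA, mapOfMatrix ε B hB, fun h x => ?_, fun h x => ?_,
      fun p x => ?_, fun p x => ?_⟩
    · refine coords_ext fun j => (coords_map (translate_mono h ε) _ j).trans ?_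
      change ∑ i, coords x i * A i j = ∑ i, coords ((staircaseSum F C hC).map h x) i * A i j
      simp only [coords_map]
    · refine coords_ext fun j => (coords_map (translate_mono h ε) _ j).trans ?_
      change ∑ i, coords x i * B i j = ∑ i, coords ((staircaseSum F D hD).map h x) i * B i j
      simp only [coords_map]
    · refine coords_ext fun k => ?_
      exact (key hAB (coords x) k).trans (coords_map _ x k).symm
    · refine coords_ext fun k => ?_
      exact (key hBA (coords x) k).trans (coords_map _ x k).symm

end Staircases

namespace Reduction

open PersistenceModule

/-! ### The modules of the reduction are sums of staircases -/

section Presentation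

/-- The grade of the generator with offset `o` in slot `t`. -/
def corner (n t : ℕ) (o : Bool × Bool) : ℝ × ℝ := ((xCoord t o : ℝ), (yCoord n t : ℝ))

/-- The corners of the staircase `i`. -/
noncomputable def corners (n : ℕ) (o : ℕ → ℕ → Bool × Bool) (i : Fin n) : Finset (ℝ × ℝ) := by
  classical exact (Finset.range (2 * n + 1)).image fun t => corner n t (o t i)

variable {n : ℕ} {o : ℕ → ℕ → Bool × Bool}

theorem mem_staircase_corners {i : Fin n} {p : ℝ × ℝ} :
    p ∈ staircase (corners n o i) ↔ ∃ t ≤ 2 * n, corner n t (o t i) ≤ p := by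
  simp [staircase, corners]

theorem corners_nonempty (i : Fin n) : (corners n o i).Nonempty := by
  classical exact Finset.Nonempty.image ⟨0, by simp⟩ _

theorem index_div {t : ℕ} (i : Fin n) : (t * n + i) / n = t := by
  have hn : 0 < n := i.pos
  rw [Nat.add_comm, Nat.add_mul_div_right _ _ hn, Nat.div_eq_of_lt i.2, Nat.zero_add]

theorem index_mod {t : ℕ} (i : Fin n) : (t * n + i) % n = i := by
  rw [Nat.add_comm, Nat.add_mul_mod_self_right, Nat.mod_eq_of_lt i.2]

theorem index_lt {m t : ℕ} (ht : t < m) (i : Fin n) : t * n + i < m * n := by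
  have := i.2
  calc t * n + i < (t + 1) * n := by rw [Nat.succ_mul]; omega
    _ ≤ m * n := Nat.mul_le_mul_right _ ht

variable (F : Type) [Field F]

/-- The graded matrix of the reduction, with real grades. -/
abbrev realMatrix (n : ℕ) (o : ℕ → ℕ → Bool × Bool) : GradedMatrix ℝ F :=
  (gradedMatrix F n o).toReal

theorem gens_realMatrix (k : Fin (realMatrix F n o).numGens) :
    (realMatrix F n o).gens k = corner n (k / n) (o (k / n) (k % n)) :=
  Prod.ext (Int.cast_natCast _) (Int.cast_natCast _)

theorem rels_realMatrix (k : Fin (realMatrix F n o).numRels) :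
    (realMatrix F n o).rels k =
      ((corner n (k / n + 1) (o (k / n + 1) (k % n))).1,
        (corner n (k / n) (o (k / n) (k % n))).2) :=
  Prod.ext (Int.cast_natCast _) (Int.cast_natCast _)

/-- The basis vector of the generator of `i` in slot `t`. -/
def genVec (n : ℕ) (o : ℕ → ℕ → Bool × Bool) (t : ℕ) (i : Fin n) :
    Fin (realMatrix F n o).numGens → F :=
  fun l => if (l : ℕ) = t * n + i then 1 else 0

variable {F}

theorem matrix_realMatrix {t : ℕ} (ht : t < 2 * n) (i : Fin n) :
    (realMatrix F n o).matrix ⟨t * n + i, index_lt ht i⟩ =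
      genVec F n o t i - genVec F n o (t + 1) i := by
  funext l
  have hn : 0 < n := i.pos
  change (if (l : ℕ) = t * n + i then (1 : F) else if (l : ℕ) = t * n + i + n then -1 else 0) = _
  simp only [genVec, Pi.sub_apply, Nat.succ_mul]
  split_ifs <;> first | omega | simp

/-- For each of the `n` summands, the sum of the coefficients of its generators. -/
def sums (x : Fin (realMatrix F n o).numGens → F) (i : Fin n) : F :=
  ∑ t : Fin (2 * n + 1), x ⟨t * n + i, index_lt t.2 i⟩

theorem sums_genVec {t : ℕ} (ht : t ≤ 2 * n) (i j : Fin n) :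
    sums (genVec F n o t i) j = if i = j then 1 else 0 := by
  have hn : 0 < n := i.pos
  have key (s : ℕ) : s * n + j = t * n + i ↔ s = t ∧ i = j := by
    refine ⟨fun h => ⟨?_, ?_⟩, ?_⟩
    · rw [← index_div (t := s) j, h, index_div]
    · rw [Fin.ext_iff, ← index_mod (t := t) i, ← h, index_mod]
    · rintro ⟨rfl, rfl⟩; rfl
  simp only [sums, genVec, key]
  split_ifs with h
  · rw [Finset.sum_eq_single (⟨t, by omega⟩ : Fin (2 * n + 1))]
    · simp [h]
    · intro s _ hs
      rw [if_neg fun h' => hs (Fin.ext h'.1)]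
    · simp
  · exact Finset.sum_eq_zero fun s _ => if_neg fun h' => h h'.2

theorem sums_add (x y : Fin (realMatrix F n o).numGens → F) (i : Fin n) :
    sums (o := o) (x + y) i = sums (o := o) x i + sums (o := o) y i :=
  Finset.sum_add_distrib

theorem sums_smul (c : F) (x : Fin (realMatrix F n o).numGens → F) (i : Fin n) :
    sums (o := o) (c • x) i = c * sums (o := o) x i :=
  (Finset.mul_sum ..).symm

theorem sums_sub (x y : Fin (realMatrix F n o).numGens → F) (i : Fin n) :
    sums (o := o) (x - y) i = sums (o := o) x i - sums (o := o) y i :=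
  Finset.sum_sub_distrib ..

theorem eq_sum_genVec (x : Fin (realMatrix F n o).numGens → F) :
    x = ∑ i : Fin n, ∑ t : Fin (2 * n + 1), x ⟨t * n + i, index_lt t.2 i⟩ • genVec F n o t i := by
  funext l
  have hl : (l : ℕ) < (2 * n + 1) * n := l.2
  have hn : 0 < n := Nat.pos_of_ne_zero fun h => by simp [h] at hl
  have e : (l : ℕ) / n * n + l % n = l := Nat.div_add_mod' l n
  rw [Finset.sum_apply, Finset.sum_eq_single ⟨l % n, Nat.mod_lt _ hn⟩, Finset.sum_apply,
    Finset.sum_eq_single ⟨l / n, Nat.div_lt_of_lt_mul (by rwa [Nat.mul_comm])⟩]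
  · simp [genVec, e]
  · intro t _ ht
    have : (l : ℕ) ≠ t * n + l % n := fun h => ht (Fin.ext (by
      change (t : ℕ) = l / n
      rw [h]
      exact (index_div ⟨l % n, Nat.mod_lt _ hn⟩).symm))
    simp [genVec, this]
  · simp
  · intro i _ hi
    rw [Finset.sum_apply]
    refine Finset.sum_eq_zero fun t _ => ?_
    have : (l : ℕ) ≠ t * n + i := fun h => hi (Fin.ext (by
      change (i : ℕ) = l % n
      rw [h, index_mod]))
    simp [genVec, this]
  · simp

theorem xCoord_le {s t : ℕ} (h : s ≤ t) (i : ℕ) : xCoord s (o s i) ≤ xCoord t (o t i) := by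
  rcases h.eq_or_lt with rfl | h
  · exact le_rfl
  · exact xCoord_mono' h _ _

/-- If the generators of `i` in the slots `s` and `t` are present at `p`, they are identified by
the relations at `p`, as so are all the generators in between. -/
theorem genVec_sub_mem {s t : ℕ} (hst : s ≤ t) (ht : t ≤ 2 * n) (i : Fin n) {p : ℝ × ℝ}
    (hs : corner n s (o s i) ≤ p) (ht' : corner n t (o t i) ≤ p) :
    genVec F n o s i - genVec F n o t i ∈ (realMatrix F n o).relSpace p := by
  suffices H : ∀ d, s + d ≤ t →
      genVec F n o s i - genVec F n o (s + d) i ∈ (realMatrix F n o).relSpace p by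
    simpa [Nat.add_sub_of_le hst] using H (t - s) (by omega)
  intro d
  induction d with
  | zero => simp
  | succ d ih =>
    intro hd
    rw [← sub_add_sub_cancel _ (genVec F n o (s + d) i)]
    refine Submodule.add_mem _ (ih (by omega)) (Submodule.subset_span ?_)
    refine ⟨⟨(s + d) * n + i, index_lt (by omega) i⟩, ?_, (matrix_realMatrix (by omega) i).symm⟩
    rw [rels_realMatrix]
    simp only [index_div, index_mod]
    refine ⟨le_trans ?_ ht'.1, le_trans ?_ hs.2⟩
    · exact Nat.cast_le.2 (xCoord_le hd i)
    · exact Nat.cast_le.2 (yCoord_anti' n _ _ (Nat.le_add_right s d))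

theorem genVec_sub_mem' {s t : ℕ} (hs : s ≤ 2 * n) (ht : t ≤ 2 * n) (i : Fin n) {p : ℝ × ℝ}
    (hs' : corner n s (o s i) ≤ p) (ht' : corner n t (o t i) ≤ p) :
    genVec F n o s i - genVec F n o t i ∈ (realMatrix F n o).relSpace p := by
  rcases le_total s t with h | h
  · exact genVec_sub_mem h ht i hs' ht'
  · rw [← neg_sub]
    exact Submodule.neg_mem _ (genVec_sub_mem h hs i ht' hs')

theorem mem_genSpace_iff {p : ℝ × ℝ} {x : Fin (realMatrix F n o).numGens → F} :
    x ∈ (realMatrix F n o).genSpace p ↔ ∀ (t : Fin (2 * n + 1)) (i : Fin n),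
      ¬ corner n t (o t i) ≤ p → x ⟨t * n + i, index_lt t.2 i⟩ = 0 := by
  constructor
  · intro h t i hp
    refine h _ ?_
    rw [gens_realMatrix]
    simpa only [index_div, index_mod] using hp
  · intro h l hl
    have hl' : (l : ℕ) < (2 * n + 1) * n := l.2
    have hn : 0 < n := Nat.pos_of_ne_zero fun h => by simp [h] at hl'
    rw [gens_realMatrix] at hl
    have := h ⟨l / n, Nat.div_lt_of_lt_mul (by rwa [Nat.mul_comm])⟩ ⟨l % n, Nat.mod_lt _ hn⟩ hl
    simp only [Nat.div_add_mod'] at this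
    exact this

theorem sums_eq_zero_of_mem_relSpace {p : ℝ × ℝ} {x : Fin (realMatrix F n o).numGens → F}
    (hx : x ∈ (realMatrix F n o).relSpace p) (i : Fin n) : sums (o := o) x i = 0 := by
  induction hx using Submodule.span_induction with
  | mem x h =>
    obtain ⟨k, -, rfl⟩ := h
    have hk : (k : ℕ) < 2 * n * n := k.2
    have hn : 0 < n := i.pos
    have ht : (k : ℕ) / n < 2 * n := Nat.div_lt_of_lt_mul (by rwa [Nat.mul_comm])
    have e : k = ⟨k / n * n + (⟨k % n, Nat.mod_lt _ hn⟩ : Fin n), index_lt ht _⟩ :=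
      Fin.ext (Nat.div_add_mod' k n).symm
    rw [e, matrix_realMatrix ht, sums_sub, sums_genVec (by omega), sums_genVec (by omega), sub_self]
  | zero => exact Finset.sum_const_zero
  | add x y _ _ hx hy => rw [sums_add, hx, hy, add_zero]
  | smul c x _ hx => rw [sums_smul, hx, mul_zero]

/-- A vector of `Gen_p` whose sums of coefficients vanish lies in `Rel_p`. -/
theorem mem_relSpace_of_sums {p : ℝ × ℝ} {x : Fin (realMatrix F n o).numGens → F}
    (hx : x ∈ (realMatrix F n o).genSpace p) (h : ∀ i, sums (o := o) x i = 0) :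
    x ∈ (realMatrix F n o).relSpace p := by
  rw [mem_genSpace_iff] at hx
  rw [eq_sum_genVec x]
  refine Submodule.sum_mem _ fun i _ => ?_
  by_cases hs : ∃ s ≤ 2 * n, corner n s (o s i) ≤ p
  · obtain ⟨s, hs, hsp⟩ := hs
    -- the coefficients sum to zero, so that one generator may be subtracted from all of them
    have e : ∑ t : Fin (2 * n + 1), x ⟨t * n + i, index_lt t.2 i⟩ • genVec F n o t i =
        ∑ t : Fin (2 * n + 1), x ⟨t * n + i, index_lt t.2 i⟩ •
          (genVec F n o t i - genVec F n o s i) := by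
      simp only [smul_sub, Finset.sum_sub_distrib, ← Finset.sum_smul]
      rw [show (∑ t : Fin (2 * n + 1), x ⟨t * n + i, index_lt t.2 i⟩) = 0 from h i, zero_smul,
        sub_zero]
    rw [e]
    refine Submodule.sum_mem _ fun t _ => ?_
    by_cases ht : corner n t (o t i) ≤ p
    · exact Submodule.smul_mem _ _ (genVec_sub_mem' (by omega) hs i ht hsp)
    · rw [hx t i ht, zero_smul]
      exact Submodule.zero_mem _
  · refine Submodule.sum_mem _ fun t _ => ?_
    rw [hx t i fun ht => hs ⟨t, by omega, ht⟩, zero_smul]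
    exact Submodule.zero_mem _

/-- The map from `Gen_p` to the sum of the staircase modules. -/
noncomputable def genMap (p : ℝ × ℝ) : (realMatrix F n o).genSpace p →ₗ[F]
    (staircaseSum F (corners n o) corners_nonempty).obj p where
  toFun x := ofCoords (sums x.1) fun i hi => Finset.sum_eq_zero fun t _ =>
    mem_genSpace_iff.1 x.2 t i fun h => hi (mem_staircase_corners.2 ⟨t, by omega, h⟩)
  map_add' x y := coords_ext fun i => sums_add x.1 y.1 i
  map_smul' c x := coords_ext fun i => sums_smul c x.1 i

theorem coords_genMap {p : ℝ × ℝ} (x : (realMatrix F n o).genSpace p) (i : Fin n) :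
    coords (genMap p x) i = sums x.1 i := rfl

theorem genMap_surjective (p : ℝ × ℝ) :
    Function.Surjective (genMap (F := F) (n := n) (o := o) p) := by
  intro y
  -- choose a generator that is present at `p` for every staircase containing `p`
  have hs (i : Fin n) : ∃ s ≤ 2 * n, p ∈ staircase (corners n o i) → corner n s (o s i) ≤ p := by
    by_cases h : p ∈ staircase (corners n o i)
    · obtain ⟨s, hs, hsp⟩ := mem_staircase_corners.1 h
      exact ⟨s, hs, fun _ => hsp⟩
    · exact ⟨0, Nat.zero_le _, fun h' => absurd h' h⟩
  choose s hs hsp using hs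
  have hx : ∑ i, coords y i • genVec F n o (s i) i ∈ (realMatrix F n o).genSpace p := by
    refine Submodule.sum_mem _ fun i _ => ?_
    by_cases h : p ∈ staircase (corners n o i)
    · refine Submodule.smul_mem _ _ fun l hl => if_neg fun hl' => hl ?_
      rw [gens_realMatrix, hl', index_div, index_mod]
      exact hsp i h
    · rw [coords_eq_zero y h, zero_smul]
      exact Submodule.zero_mem _
  refine ⟨⟨_, hx⟩, coords_ext fun j => ?_⟩
  rw [coords_genMap]
  have h (S : Finset (Fin n)) : sums (o := o) (∑ i ∈ S, coords y i • genVec F n o (s i) i) j =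
      ∑ i ∈ S, coords y i * if i = j then 1 else 0 := by
    classical
    induction S using Finset.induction_on with
    | empty => exact Finset.sum_const_zero
    | insert i S hi ih =>
      rw [Finset.sum_insert hi, Finset.sum_insert hi, sums_add, ih, sums_smul, sums_genVec (hs i)]
  rw [h]
  simp

/-- The sums of coefficients vanish on the relations and only there, and take all values, so that
they identify `Gen_p / Rel_p` with the sum of the staircase modules at `p`. -/
theorem isomorphic_staircaseSum : (gradedMatrix F n o).persistenceModule.Isomorphic
    (staircaseSum F (corners n o) corners_nonempty) := by
  refine ⟨⟨fun p => ((realMatrix F n o).relIn p).liftQ (genMap p) fun x hx => ?_,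
    fun {p q} h => ?_⟩, fun p => ⟨?_, ?_⟩⟩
  · exact coords_ext fun i => sums_eq_zero_of_mem_relSpace hx i
  · refine Submodule.linearMap_qext _ (LinearMap.ext fun x => coords_ext fun i => ?_)
    exact coords_map h _ i
  · rw [← LinearMap.ker_eq_bot]
    refine Submodule.ker_liftQ_eq_bot _ _ _ fun x hx => ?_
    refine mem_relSpace_of_sums x.2 fun i => ?_
    exact congrArg (fun y => coords y i) (show genMap p x = 0 from hx)
  · exact fun y => (genMap_surjective p y).elim fun x hx => ⟨Submodule.Quotient.mk x, hx⟩

end Presentation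

/-! ### The distance of the modules of the reduction -/

/-- The number with the binary digits `o`, the lowest one first. -/
def offsetVal (o : Bool × Bool) : ℕ := 2 * o.2.toNat + o.1.toNat

theorem offsetVal_le (o : Bool × Bool) : offsetVal o ≤ 3 := by
  have := Bool.toNat_le o.1
  have := Bool.toNat_le o.2
  rw [offsetVal]
  omega

section Containment

variable {n : ℕ} {o o' : ℕ → ℕ → Bool × Bool} {i j : Fin n} {ε : ℝ}

theorem translate_mem_of_offsetVal_le (hε : 0 ≤ ε)
    (h : ∀ t ≤ 2 * n, (offsetVal (o' t j) : ℝ) ≤ offsetVal (o t i) + ε) {p : ℝ × ℝ}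
    (hp : p ∈ staircase (corners n o i)) : translate p ε ∈ staircase (corners n o' j) := by
  obtain ⟨t, ht, h₁, h₂⟩ := mem_staircase_corners.1 hp
  refine mem_staircase_corners.2 ⟨t, ht, ?_, h₂.trans (le_add_of_nonneg_right hε)⟩
  have h := h t ht
  simp only [corner, xCoord_eq, PersistenceModule.translate, offsetVal] at h h₁ ⊢
  push_cast at h h₁ ⊢
  linarith

/-- Distinct slots are so far apart that a translation by less than `3` can move a corner only
above the corner in the same slot. -/
theorem offsetVal_le_of_translate_mem (hε : ε < 3)
    (h : ∀ p ∈ staircase (corners n o i), translate p ε ∈ staircase (corners n o' j)) {t : ℕ}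
    (ht : t ≤ 2 * n) : (offsetVal (o' t j) : ℝ) ≤ offsetVal (o t i) + ε := by
  obtain ⟨s, hs, h₁, h₂⟩ :=
    mem_staircase_corners.1 (h _ (mem_staircase_corners.2 ⟨t, ht, le_refl (corner n t (o t i))⟩))
  simp only [corner, PersistenceModule.translate] at h₁ h₂
  rcases lt_trichotomy s t with hst | rfl | hst
  · have := (Nat.cast_le (α := ℝ)).2 (yCoord_anti hst ht)
    push_cast at this
    linarith
  · simp only [xCoord_eq, offsetVal] at h₁ ⊢
    push_cast at h₁ ⊢
    linarith
  · have := (Nat.cast_le (α := ℝ)).2 (xCoord_mono hst (o t i) (o' s j))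
    push_cast at this
    linarith

end Containment

theorem offsetVal_offsetN_le (I : CIInstance) {i j : Fin I.n} (h : (i, j) ∉ I.P) (t : ℕ) :
    offsetVal (offsetN I t j) ≤ offsetVal (offsetM I t i) + 1 := by
  simp only [offsetN, offsetM]
  split_ifs with h₀ h₁
  · decide
  · by_cases hi : t - 1 = i
    · simp [hi, entryBit, h, offsetVal]
    · have := Bool.toNat_le (entryBit I.P (t - 1) j)
      simp [hi, offsetVal]
      omega
  · simp only [offsetVal, Bool.toNat_true, Bool.toNat_false]
    have := Bool.toNat_le (decide (t - 1 - I.n ≠ j))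
    omega

theorem offsetVal_offsetM_le (I : CIInstance) {i j : Fin I.n} (h : (i, j) ∉ I.Q) (t : ℕ) :
    offsetVal (offsetM I t j) ≤ offsetVal (offsetN I t i) + 1 := by
  simp only [offsetN, offsetM]
  split_ifs with h₀ h₁
  · decide
  · simp only [offsetVal, Bool.toNat_true, Bool.toNat_false]
    have := Bool.toNat_le (decide (t - 1 ≠ j))
    omega
  · by_cases hi : t - 1 - I.n = i
    · simp [hi, entryBit, h, offsetVal]
    · have := Bool.toNat_le (entryBit I.Q (t - 1 - I.n) j)
      simp [hi, offsetVal]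
      omega

theorem offsetVal_of_mem_P {I : CIInstance} {i j : Fin I.n} (h : (i, j) ∈ I.P) :
    offsetVal (offsetN I (i + 1) j) = offsetVal (offsetM I (i + 1) i) + 3 := by
  have hi : (i : ℕ) + 1 ≤ I.n := i.2
  simp [offsetN, offsetM, hi, entryBit, h, offsetVal]

theorem offsetVal_of_mem_Q {I : CIInstance} {i j : Fin I.n} (h : (i, j) ∈ I.Q) :
    offsetVal (offsetM I (I.n + i + 1) j) = offsetVal (offsetN I (I.n + i + 1) i) + 3 := by
  have hi : ¬ I.n + (i : ℕ) + 1 ≤ I.n := by omega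
  simp [offsetN, offsetM, hi, entryBit, h, offsetVal]

variable {F : Type} [Field F]

theorem interleaved_modulePair_iff (I : CIInstance) (ε : ℝ≥0) :
    Interleaved (modulePair F I).1.persistenceModule (modulePair F I).2.persistenceModule ε ↔
      ∃ A B : Matrix (Fin I.n) (Fin I.n) F,
        (∀ i j, A i j ≠ 0 → ∀ p ∈ staircase (corners I.n (offsetM I) i),
          translate p ε ∈ staircase (corners I.n (offsetN I) j)) ∧
        (∀ i j, B i j ≠ 0 → ∀ p ∈ staircase (corners I.n (offsetN I) i),
          translate p ε ∈ staircase (corners I.n (offsetM I) j)) ∧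
        A * B = 1 :=
  (interleaved_congr isomorphic_staircaseSum isomorphic_staircaseSum).trans
    (interleaved_staircaseSum_iff corners_nonempty corners_nonempty ε)

theorem interleaved_three (I : CIInstance) : Interleaved (modulePair F I).1.persistenceModule
    (modulePair F I).2.persistenceModule 3 := by
  have h (a b : Bool × Bool) : (offsetVal a : ℝ) ≤ offsetVal b + (3 : ℝ≥0) := by
    have : (offsetVal a : ℝ) ≤ 3 := mod_cast offsetVal_le a
    have : (0 : ℝ) ≤ offsetVal b := Nat.cast_nonneg _
    push_cast
    linarith
  exact (interleaved_modulePair_iff I 3).2 ⟨1, 1,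
    fun i j _ p hp => translate_mem_of_offsetVal_le (NNReal.coe_nonneg _) (fun t _ => h _ _) hp,
    fun i j _ p hp => translate_mem_of_offsetVal_le (NNReal.coe_nonneg _) (fun t _ => h _ _) hp,
    one_mul 1⟩

theorem interleaved_one {I : CIInstance} (h : I.InCI F) :
    Interleaved (modulePair F I).1.persistenceModule (modulePair F I).2.persistenceModule 1 := by
  obtain ⟨A, B, hA, hB, hAB⟩ := h
  refine (interleaved_modulePair_iff I 1).2 ⟨A, B,
    fun i j h p hp => translate_mem_of_offsetVal_le (NNReal.coe_nonneg _) (fun t _ => ?_) hp,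
    fun i j h p hp => translate_mem_of_offsetVal_le (NNReal.coe_nonneg _) (fun t _ => ?_) hp, hAB⟩
  · exact_mod_cast offsetVal_offsetN_le I (fun hP => h (hA _ hP)) t
  · exact_mod_cast offsetVal_offsetM_le I (fun hQ => h (hB _ hQ)) t

theorem inCI_of_interleaved {I : CIInstance} {ε : ℝ≥0} (hε : ε < 3)
    (h : Interleaved (modulePair F I).1.persistenceModule
      (modulePair F I).2.persistenceModule ε) : I.InCI F := by
  have hε : (ε : ℝ) < 3 := mod_cast hε
  obtain ⟨A, B, hA, hB, hAB⟩ := (interleaved_modulePair_iff I ε).1 h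
  refine ⟨A, B, fun ⟨i, j⟩ hP => ?_, fun ⟨i, j⟩ hQ => ?_, hAB⟩
  · by_contra h
    have := offsetVal_le_of_translate_mem hε (hA i j h) (t := i + 1) (by omega)
    rw [offsetVal_of_mem_P hP] at this
    push_cast at this
    linarith
  · by_contra h
    have := offsetVal_le_of_translate_mem hε (hB i j h) (t := I.n + i + 1) (by omega)
    rw [offsetVal_of_mem_Q hQ] at this
    push_cast at this
    linarith

/-- In slot `0`, every staircase of the first module lies one unit to the right of every staircase
of the second one. -/
theorem one_le_of_interleaved {I : CIInstance} (hI : 0 < I.n) {ε : ℝ≥0}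
    (h : Interleaved (modulePair F I).1.persistenceModule
      (modulePair F I).2.persistenceModule ε) : 1 ≤ ε := by
  by_contra! hε
  have hε : (ε : ℝ) < 1 := mod_cast hε
  obtain ⟨A, B, -, hB, hAB⟩ := (interleaved_modulePair_iff I ε).1 h
  have : B = 0 := by
    ext i j
    by_contra h
    have := offsetVal_le_of_translate_mem (by linarith) (hB i j h) (Nat.zero_le _)
    simp [offsetM, offsetN, offsetVal] at this
    linarith
  have : NeZero I.n := ⟨hI.ne'⟩
  rw [‹B = 0›, mul_zero] at hAB
  exact zero_ne_one hAB

end Reduction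

theorem mainTheorem2 (F : Type) [Field F] [Finite F] :
    ∃ f : CIInstance → GradedMatrix ℤ F × GradedMatrix ℤ F,
      Nonempty (Turing.TM2ComputableInPolyTime CIInstance.encode encodeGMPair f) ∧
      ∀ I : CIInstance, 0 < I.n →
        (I.InCI F → (f I).1.persistenceModule.interleavingDist (f I).2.persistenceModule = 1) ∧
        (¬ I.InCI F → (f I).1.persistenceModule.interleavingDist (f I).2.persistenceModule = 3) ∧
        (f I).1.persistenceModule.IsSumOfStaircases I.n ∧
        (f I).2.persistenceModule.IsSumOfStaircases I.n ∧
        (f I).1.persistenceModule.IntervalDecomposable ∧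
        (f I).2.persistenceModule.IntervalDecomposable := by
  refine ⟨Reduction.modulePair F, Reduction.nonempty_computable F, fun I hI => ?_⟩
  have hM : (Reduction.modulePair F I).1.persistenceModule.IsSumOfStaircases I.n :=
    ⟨_, Reduction.corners_nonempty, Reduction.isomorphic_staircaseSum⟩
  have hN : (Reduction.modulePair F I).2.persistenceModule.IsSumOfStaircases I.n :=
    ⟨_, Reduction.corners_nonempty, Reduction.isomorphic_staircaseSum⟩
  refine ⟨fun h => ?_, fun h => ?_, hM, hN, hM.intervalDecomposable, hN.intervalDecomposable⟩
  · refine le_antisymm (iInf₂_le 1 (Reduction.interleaved_one h)) (le_iInf₂ fun ε hε => ?_)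
    exact_mod_cast Reduction.one_le_of_interleaved hI hε
  · refine le_antisymm (iInf₂_le 3 (Reduction.interleaved_three I)) (le_iInf₂ fun ε hε => ?_)
    have : 3 ≤ ε := not_lt.1 fun hlt => h (Reduction.inCI_of_interleaved hlt hε)
    exact_mod_cast this
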